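/- **Definitions.** All Banach spaces are real. *Lipschitz-free space.* For a metric space $M$ with a base point $0\in M$, let $\mathrm{Lip}_0(M)$ be the space of Lipschitz functions $f:M\to\mathbb R$ with $f(0)=0$, normed by the best Lipschitz constant $\|f\|_L=\sup_{x\ne y}\frac{f(x)-f(y)}{d(x,y)}$. For $x\in M$ let $\delta(x)\in\mathrm{Lip}_0(M)^*$ be the evaluation $f\mapsto f(x)$. The Lipschitz-free space $\mathcal F(M)$ is the norm-closed linear span of $\{\delta(x):x\in M\}$ in $\mathrm{Lip}_0(M)^*$. *Weak-fragmentability index.* For a Banach space $X$, a weakly closed bounded set $K\subset X$ and $\varepsilon>0$, let $$\sigma_\varepsilon(K)=K\setminus\bigcup\{V\subset X : V \text{ weakly open and } \operatorname{diam}(V\cap K)<\varepsilon\}.$$ Put $\sigma^0_\varepsilon(K)=K$, $\sigma^{\alpha+1}_\varepsilon(K)=\sigma_\varepsilon(\sigma^\alpha_\varepsilon(K))$, and $\sigma^\alpha_\varepsilon(K)=\bigcap_{\beta<\alpha}\sigma^\beta_\varepsilon(K)$ for limit ordinals $\alpha$. Let $\Phi(X,\varepsilon)$ be the least ordinal $\alpha$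 with $\sigma^\alpha_\varepsilon(B_X)=\emptyset$, where $B_X$ is the closed unit ball ($\infty$ if there is no such $\alpha$), and let $\Phi(X)=\sup_{\varepsilon>0}\Phi(X,\varepsilon)$ ($\Phi(X)=\infty$ if some $\Phi(X,\varepsilon)$ is $\infty$). *Diamond graphs.* $D_1$ is the graph with two poles $t_1,b_1$ and midpoints $x_1^n$ ($n\in\mathbb N$), whose edges join each midpoint to both poles, equipped with its shortest-path distance. For $1\le n<\omega$, $D_{n+1}$ is obtained from $D_1$ by replacing each edge by a copy of $D_n$ with its distance divided by $2$, equipped with the resulting shortest-path distance: the upper and lower ends of the edge become the poles $t_n$ and $b_n$ of that copy, and the poles of $D_1$ become the poles $t_{n+1},b_{n+1}$ of $D_{n+1}$. In every $D_n$ the two poles are at distance $2$. The space $D_\omega$ is obtained by gluing all the $D_n$, $1\le n<\omega$, along their top poles and along their bottom poles: the distance $d_\omega$ extends each $d_n$, and for $x\in D_n$, $y\in D_m$ with $n\neq m$, $$d_\omega(x,y)=\min\bigl(d_n(x,t_n)+d_m(t_m,y),\ d_n(x,b_n)+d_m(b_m,y)\bigr).$$ Its base point is the first midpoint $x_1^1$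 of $D_1$. **Proposition 3.10.** $\Phi(\mathcal F(D_\omega))=\omega^2$; in particular the index is well defined (not $\infty$). -/

import Mathlib

noncomputable section

/-! ### Lipschitz-free spaces -/

/-- The linear space of Lipschitz functions `M → ℝ` vanishing at the base point `x₀`,
as a subspace of the space of all functions. -/
def lipZeroSubmodule (M : Type*) [MetricSpace M] (x₀ : M) : Submodule ℝ (M → ℝ) where
  carrier := {f | f x₀ = 0 ∧ ∃ K, LipschitzWith K f}
  zero_mem' := ⟨rfl, 0, LipschitzWith.const 0⟩
  add_mem' := by
    rintro f g ⟨hf, K, hK⟩ ⟨hg, L, hL⟩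
    exact ⟨by simp [hf, hg], K + L, hK.add hL⟩
  smul_mem' := by
    rintro c f ⟨hf, K, hK⟩
    exact ⟨by simp [hf], ‖c‖₊ * K, (lipschitzWith_smul c).comp hK⟩

/-- `Lip₀(M)`: a separate type, so that it carries the topology of the Lipschitz norm and not
the topology of pointwise convergence. -/
def LipZero (M : Type*) [MetricSpace M] (x₀ : M) : Type _ := lipZeroSubmodule M x₀

namespace LipZero

variable {M : Type*} [MetricSpace M] {x₀ : M}

instance : AddCommGroup (LipZero M x₀) := inferInstanceAs (AddCommGroup (lipZeroSubmodule M x₀))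

instance : Module ℝ (LipZero M x₀) := inferInstanceAs (Module ℝ (lipZeroSubmodule M x₀))

instance : CoeFun (LipZero M x₀) (fun _ => M → ℝ) := ⟨fun f => f.1⟩

@[ext] theorem ext {f g : LipZero M x₀} (h : ∀ x, f x = g x) : f = g := Subtype.ext (funext h)

@[simp] theorem add_apply (f g : LipZero M x₀) (x : M) : (f + g) x = f x + g x := rfl

@[simp] theorem smul_apply (c : ℝ) (f : LipZero M x₀) (x : M) : (c • f) x = c * f x := rfl

@[simp] theorem zero_apply (x : M) : (0 : LipZero M x₀) x = 0 := rfl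

theorem apply_base (f : LipZero M x₀) : f x₀ = 0 := f.2.1

/-- The set of slopes of `f`. -/
def slopes (f : LipZero M x₀) : Set ℝ := {r | ∃ x y : M, x ≠ y ∧ r = (f x - f y) / dist x y}

/-- The norm of `Lip₀(M)` is the best Lipschitz constant, i.e. the supremum of the slopes. -/
instance : Norm (LipZero M x₀) := ⟨fun f => sSup f.slopes⟩

theorem norm_def (f : LipZero M x₀) : ‖f‖ = sSup f.slopes := rfl

theorem bddAbove_slopes (f : LipZero M x₀) : BddAbove f.slopes := by
  obtain ⟨-, K, hK⟩ := f.2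
  refine ⟨K, ?_⟩
  rintro r ⟨x, y, hxy, rfl⟩
  rw [div_le_iff₀ (dist_pos.2 hxy)]
  exact (le_abs_self _).trans (hK.dist_le_mul x y)

theorem abs_sub_le (f : LipZero M x₀) (x y : M) : |f x - f y| ≤ ‖f‖ * dist x y := by
  have key : ∀ x y : M, x ≠ y → f x - f y ≤ ‖f‖ * dist x y := fun x y hxy => by
    rw [← div_le_iff₀ (dist_pos.2 hxy)]
    exact le_csSup f.bddAbove_slopes ⟨x, y, hxy, rfl⟩
  rcases eq_or_ne x y with rfl | hxy
  · simp
  · rw [abs_le]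
    have h1 := key x y hxy
    have h2 := key y x hxy.symm
    rw [dist_comm] at h2
    constructor <;> linarith

theorem norm_nonneg' (f : LipZero M x₀) : 0 ≤ ‖f‖ := by
  by_cases h : ∃ x y : M, x ≠ y
  · obtain ⟨x, y, hxy⟩ := h
    exact nonneg_of_mul_nonneg_left ((abs_nonneg _).trans (f.abs_sub_le x y)) (dist_pos.2 hxy)
  · have : f.slopes = ∅ := by
      ext r
      simp only [slopes, Set.mem_ofPred_eq, Set.mem_empty_iff_false, iff_false]
      rintro ⟨x, y, hxy, -⟩
      exact h ⟨x, y, hxy⟩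
    rw [norm_def, this, Real.sSup_empty]

theorem norm_le_of_forall {f : LipZero M x₀} {C : ℝ} (hC : 0 ≤ C)
    (h : ∀ x y, |f x - f y| ≤ C * dist x y) : ‖f‖ ≤ C := by
  refine Real.sSup_le ?_ hC
  rintro r ⟨x, y, hxy, rfl⟩
  rw [div_le_iff₀ (dist_pos.2 hxy)]
  exact (le_abs_self _).trans (h x y)

theorem norm_smul_le' (c : ℝ) (f : LipZero M x₀) : ‖c • f‖ ≤ ‖c‖ * ‖f‖ := by
  refine norm_le_of_forall (mul_nonneg (norm_nonneg c) f.norm_nonneg') fun x y => ?_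
  have : |(c • f) x - (c • f) y| = ‖c‖ * |f x - f y| := by
    rw [smul_apply, smul_apply, ← mul_sub, abs_mul, Real.norm_eq_abs]
  rw [this, mul_assoc]
  exact mul_le_mul_of_nonneg_left (f.abs_sub_le x y) (norm_nonneg c)

theorem normedSpaceCore (M : Type*) [MetricSpace M] (x₀ : M) :
    NormedSpace.Core ℝ (LipZero M x₀) where
  norm_nonneg := norm_nonneg'
  norm_smul c f := by
    refine le_antisymm (norm_smul_le' c f) ?_
    rcases eq_or_ne c 0 with rfl | hc
    · simpa using norm_nonneg' _
    · have h := norm_smul_le' c⁻¹ (c • f)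
      rw [smul_smul, inv_mul_cancel₀ hc, one_smul, norm_inv] at h
      rwa [← div_eq_inv_mul, le_div_iff₀ (norm_pos_iff.2 hc), mul_comm] at h
  norm_triangle f g := by
    refine norm_le_of_forall (add_nonneg f.norm_nonneg' g.norm_nonneg') fun x y => ?_
    have h : (f + g) x - (f + g) y = (f x - f y) + (g x - g y) := by
      rw [add_apply, add_apply]; ring
    rw [h, add_mul]
    exact (abs_add_le _ _).trans (add_le_add (f.abs_sub_le x y) (g.abs_sub_le x y))
  norm_eq_zero_iff f := by
    constructor
    · intro h
      ext x
      have := f.abs_sub_le x x₀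
      rw [h, zero_mul, f.apply_base, sub_zero] at this
      simpa using this
    · rintro rfl
      exact le_antisymm (norm_le_of_forall le_rfl fun x y => by simp) (norm_nonneg' _)

instance : NormedAddCommGroup (LipZero M x₀) := NormedAddCommGroup.ofCore (normedSpaceCore M x₀)

instance : NormedSpace ℝ (LipZero M x₀) := NormedSpace.ofCore (normedSpaceCore M x₀)

end LipZero

/-- The evaluation functional `δ(x) : f ↦ f x` in `Lip₀(M)*`. -/
def lipDelta {M : Type*} [MetricSpace M] (x₀ x : M) : StrongDual ℝ (LipZero M x₀) :=
  LinearMap.mkContinuous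
    { toFun := fun f => f x
      map_add' := fun _ _ => rfl
      map_smul' := fun _ _ => rfl } (dist x x₀) fun f => by
    have h := f.abs_sub_le x x₀
    rw [f.apply_base, sub_zero] at h
    rw [Real.norm_eq_abs, mul_comm]
    exact h

/-- The Lipschitz-free space `𝓕(M)`: the norm-closed linear span of the evaluation functionals
in `Lip₀(M)*`. -/
def lipschitzFree (M : Type*) [MetricSpace M] (x₀ : M) :
    Submodule ℝ (StrongDual ℝ (LipZero M x₀)) :=
  (Submodule.span ℝ (Set.range (lipDelta x₀))).topologicalClosure

/-! ### The weak-fragmentability index -/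

/-- The derived set `σ_ε(K)`: remove from `K` all weakly open sets `V` of `X` such that `V ∩ K`
has diameter `< ε`. -/
def weakDerivedSet {X : Type*} [NormedAddCommGroup X] [NormedSpace ℝ X] (ε : ℝ) (K : Set X) :
    Set X :=
  K \ ⋃₀ {V : Set X | IsOpen (toWeakSpace ℝ X '' V) ∧ Metric.ediam (V ∩ K) < ENNReal.ofReal ε}

/-- The iterated derived sets `σ_ε^α(K)`. -/
def weakDerivedIter {X : Type*} [NormedAddCommGroup X] [NormedSpace ℝ X] (ε : ℝ) (K : Set X)
    (α : Ordinal) : Set X :=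
  Ordinal.limitRecOn α K (fun _ S => weakDerivedSet ε S) (fun β _ S => ⋂ γ, ⋂ h : γ < β, S γ h)

section WeakDerivedIter

universe u v

variable {X : Type u} [NormedAddCommGroup X] [NormedSpace ℝ X] (ε : ℝ) (K : Set X)

theorem weakDerivedIter_zero : weakDerivedIter ε K (0 : Ordinal.{v}) = K :=
  Ordinal.limitRecOn_zero _ _ _

theorem weakDerivedIter_add_one (α : Ordinal.{v}) :
    weakDerivedIter ε K (α + 1) = weakDerivedSet ε (weakDerivedIter ε K α) :=
  Ordinal.limitRecOn_add_one _ _ _ _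

theorem weakDerivedIter_limit (α : Ordinal.{v}) (h : Order.IsSuccLimit α) :
    weakDerivedIter ε K α = ⋂ β, ⋂ _ : β < α, weakDerivedIter ε K β :=
  Ordinal.limitRecOn_limit _ _ _ _ h

end WeakDerivedIter

universe u in
/-- `Φ(X, ε)`: the least ordinal `α` with `σ_ε^α(B_X) = ∅`, and `⊤` if there is none. -/
def weakFragIndexAt (X : Type u) [NormedAddCommGroup X] [NormedSpace ℝ X] (ε : ℝ) :
    WithTop Ordinal.{u} :=
  sInf {a | ∃ α : Ordinal.{u}, a = (α : WithTop Ordinal.{u}) ∧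
    weakDerivedIter ε (Metric.closedBall (0 : X) 1) α = ∅}

universe u in
/-- The weak-fragmentability index `Φ(X) = sup_{ε > 0} Φ(X, ε)`, with value `⊤` (for `∞`) if some
`Φ(X, ε)` is infinite. -/
def weakFragIndex (X : Type u) [NormedAddCommGroup X] [NormedSpace ℝ X] : WithTop Ordinal.{u} :=
  ⨆ ε : {ε : ℝ // 0 < ε}, weakFragIndexAt X ε

/-! ### The countably branching diamond graphs -/

/-- A metric space with a top pole and a bottom pole at distance `2` from each other. -/
structure PoledSpace where
  carrier : Type
  [metric : MetricSpace carrier]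
  top : carrier
  bot : carrier
  dist_top_bot : dist top bot = 2

attribute [instance] PoledSpace.metric

/-- The pole of `P` selected by a Boolean: the top pole for `true`, the bottom pole for `false`. -/
def PoledSpace.pole (P : PoledSpace) : Bool → P.carrier
  | true => P.top
  | false => P.bot

/-- The vertices of the countably branching diamond graph of depth one: two poles and a sequence
of midpoints. -/
inductive DiamondVertex : Type
  | top : DiamondVertex
  | bot : DiamondVertex
  | mid (n : ℕ) : DiamondVertex
  deriving DecidableEq

namespace DiamondVertex

/-- Whether a vertex is a pole. -/
def isPole : DiamondVertex → Bool
  | top => true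
  | bot => true
  | mid _ => false

/-- The graph distance of the diamond graph of depth one, in which the edges are the pairs
consisting of a pole and a midpoint: distinct vertices of the same kind are at distance `2`. -/
instance : MetricSpace DiamondVertex where
  dist x y := if x = y then 0 else if x.isPole = y.isPole then 2 else 1
  dist_self x := by simp
  dist_comm x y := by simp only [eq_comm]
  dist_triangle x y z := by
    by_cases hxy : x = y
    · subst hxy; simp
    by_cases hyz : y = z
    · subst hyz; simp
    simp only [hxy, hyz, if_false]
    split_ifs <;> norm_num
  eq_of_dist_eq_zero {x y} h := by
    by_contra hxy
    simp only [hxy, if_false] at h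
    split_ifs at h <;> norm_num at h

theorem dist_def (x y : DiamondVertex) :
    dist x y = if x = y then 0 else if x.isPole = y.isPole then 2 else 1 := rfl

end DiamondVertex

/-- The diamond graph `D₁` of depth one. -/
def diamondOne : PoledSpace where
  carrier := DiamondVertex
  top := DiamondVertex.top
  bot := DiamondVertex.bot
  dist_top_bot := by simp [DiamondVertex.dist_def, DiamondVertex.isPole]

/-- The edges of `D₁`: `(j, true)` joins the top pole to the `j`-th midpoint, and `(j, false)` joins
the `j`-th midpoint to the bottom pole. `edgeEnd e true` is the upper end of `e` and
`edgeEnd e false` the lower one. -/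
def edgeEnd : ℕ × Bool → Bool → DiamondVertex
  | (_, true), true => DiamondVertex.top
  | (j, true), false => DiamondVertex.mid j
  | (j, false), true => DiamondVertex.mid j
  | (_, false), false => DiamondVertex.bot

theorem dist_edgeEnd (P : PoledSpace) (e : ℕ × Bool) (u v : Bool) :
    dist (edgeEnd e u) (edgeEnd e v) = dist (P.pole u) (P.pole v) / 2 := by
  have h := P.dist_top_bot
  have h' := P.dist_top_bot
  rw [dist_comm] at h'
  rcases e with ⟨j, _ | _⟩ <;> cases u <;> cases v <;>
    simp [edgeEnd, PoledSpace.pole, DiamondVertex.dist_def, DiamondVertex.isPole, h, h']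

/-- A point of `D₁` with every edge replaced by a copy of `P`: an edge `e` and a point of the copy
of `P` sitting on `e`. The ends of adjacent copies are still to be identified. -/
structure EdgePoint (P : PoledSpace) where
  edge : ℕ × Bool
  pt : P.carrier

namespace EdgePoint

variable {P : PoledSpace}

/-- The length of a shortest path from `p` to `q` among those that leave the copy of `P` containing
`p` through its pole `u` and enter the copy of `P` containing `q` through its pole `v`. -/
def via (p q : EdgePoint P) (u v : Bool) : ℝ :=
  dist p.pt (P.pole u) / 2 + dist (edgeEnd p.edge u) (edgeEnd q.edge v) + dist (P.pole v) q.pt / 2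

/-- The path distance: half the distance of `P` within a copy of `P`, and otherwise the length of a
shortest path through poles. -/
def pathDist (p q : EdgePoint P) : ℝ :=
  if p.edge = q.edge then dist p.pt q.pt / 2
  else min (min (via p q true true) (via p q true false))
    (min (via p q false true) (via p q false false))

theorem pathDist_le_via (p q : EdgePoint P) (u v : Bool) : pathDist p q ≤ via p q u v := by
  unfold pathDist
  split_ifs with h
  · have h1 := dist_edgeEnd P p.edge u v
    have h2 := dist_triangle4 p.pt (P.pole u) (P.pole v) q.pt
    rw [via, ← h, h1]
    linarith
  · cases u <;> cases v <;> simp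

theorem exists_pathDist_eq_via {p q : EdgePoint P} (h : p.edge ≠ q.edge) :
    ∃ u v, pathDist p q = via p q u v := by
  unfold pathDist
  rw [if_neg h]
  rcases min_choice (min (via p q true true) (via p q true false))
    (min (via p q false true) (via p q false false)) with h1 | h1 <;> rw [h1]
  · rcases min_choice (via p q true true) (via p q true false) with h2 | h2 <;> rw [h2]
    exacts [⟨_, _, rfl⟩, ⟨_, _, rfl⟩]
  · rcases min_choice (via p q false true) (via p q false false) with h2 | h2 <;> rw [h2]
    exacts [⟨_, _, rfl⟩, ⟨_, _, rfl⟩]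

theorem via_comm (p q : EdgePoint P) (u v : Bool) : via p q u v = via q p v u := by
  simp only [via, dist_comm q.pt, dist_comm (edgeEnd q.edge v), dist_comm _ p.pt]
  ring

theorem pathDist_triangle (p q r : EdgePoint P) :
    pathDist p r ≤ pathDist p q + pathDist q r := by
  by_cases hpq : p.edge = q.edge
  · have e1 : pathDist p q = dist p.pt q.pt / 2 := if_pos hpq
    by_cases hqr : q.edge = r.edge
    · have e2 : pathDist q r = dist q.pt r.pt / 2 := if_pos hqr
      have e3 : pathDist p r = dist p.pt r.pt / 2 := if_pos (hpq.trans hqr)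
      have := dist_triangle p.pt q.pt r.pt
      linarith
    · obtain ⟨u, v, e2⟩ := exists_pathDist_eq_via hqr
      have h1 := pathDist_le_via p r u v
      have h2 := dist_triangle p.pt q.pt (P.pole u)
      rw [e1, e2]
      simp only [via, hpq] at h1 ⊢
      linarith
  · obtain ⟨u, v, e1⟩ := exists_pathDist_eq_via hpq
    by_cases hqr : q.edge = r.edge
    · have e2 : pathDist q r = dist q.pt r.pt / 2 := if_pos hqr
      have h1 := pathDist_le_via p r u v
      have h2 := dist_triangle (P.pole v) q.pt r.pt
      rw [e1, e2]
      simp only [via, ← hqr] at h1 ⊢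
      linarith
    · obtain ⟨u', v', e2⟩ := exists_pathDist_eq_via hqr
      have h1 := pathDist_le_via p r u v'
      have h2 := dist_edgeEnd P q.edge v u'
      have h3 := dist_triangle (P.pole v) q.pt (P.pole u')
      have h4 := dist_triangle4 (edgeEnd p.edge u) (edgeEnd q.edge v) (edgeEnd q.edge u')
        (edgeEnd r.edge v')
      rw [e1, e2]
      simp only [via] at h1 ⊢
      linarith

instance : PseudoMetricSpace (EdgePoint P) where
  dist := pathDist
  dist_self p := by simp [pathDist]
  dist_comm p q := by
    by_cases h : p.edge = q.edge
    · simp [pathDist, h, dist_comm]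
    · simp only [pathDist, h, Ne.symm h, if_false, via_comm p q]
      rw [min_min_min_comm]
  dist_triangle := pathDist_triangle

theorem dist_def (p q : EdgePoint P) : dist p q = pathDist p q := rfl

end EdgePoint

/-- `D₁` with each edge replaced by a copy of `P` with halved distance: the metric space obtained
from `EdgePoint P` by identifying the points at distance `0`, which glues adjacent copies of `P`
along their common end. -/
def PoledSpace.replaceEdges (P : PoledSpace) : PoledSpace where
  carrier := SeparationQuotient (EdgePoint P)
  top := SeparationQuotient.mk ⟨(0, true), P.top⟩
  bot := SeparationQuotient.mk ⟨(0, false), P.bot⟩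
  dist_top_bot := by
    have h := P.dist_top_bot
    rw [SeparationQuotient.dist_mk, EdgePoint.dist_def]
    simp [EdgePoint.pathDist, EdgePoint.via, edgeEnd, PoledSpace.pole, DiamondVertex.dist_def,
      DiamondVertex.isPole, h]
    norm_num

/-- `finiteDiamond n` is the diamond graph `D_{n+1}` of depth `n + 1`. -/
def finiteDiamond : ℕ → PoledSpace
  | 0 => diamondOne
  | n + 1 => (finiteDiamond n).replaceEdges

/-- A point of one of the spaces `D_{n+1}`, `n ∈ ℕ`, whose poles are still to be identified. -/
structure OmegaPoint where
  level : ℕ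
  pt : (finiteDiamond level).carrier

namespace OmegaPoint

/-- The distance from a point of `D_{n+1}` to one of the poles of `D_{n+1}`. -/
def poleDist (p : OmegaPoint) (u : Bool) : ℝ := dist p.pt ((finiteDiamond p.level).pole u)

open Classical in
/-- The distance of the gluing of all `D_{n+1}` along their poles: that of `D_{n+1}` within `D_{n+1}`,
and otherwise the length of a shortest path through one of the poles. -/
def glueDist (p q : OmegaPoint) : ℝ :=
  if h : q.level = p.level then dist p.pt (h ▸ q.pt)
  else min (p.poleDist true + q.poleDist true) (p.poleDist false + q.poleDist false)

theorem glueDist_mk_same (n : ℕ) (x y : (finiteDiamond n).carrier) :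
    glueDist ⟨n, x⟩ ⟨n, y⟩ = dist x y := by
  simp [glueDist]

theorem glueDist_of_ne {p q : OmegaPoint} (h : p.level ≠ q.level) : glueDist p q =
    min (p.poleDist true + q.poleDist true) (p.poleDist false + q.poleDist false) := by
  rw [glueDist, dif_neg (Ne.symm h)]

theorem glueDist_le {p q : OmegaPoint} (u : Bool) :
    glueDist p q ≤ p.poleDist u + q.poleDist u := by
  by_cases h : p.level = q.level
  · obtain ⟨n, x⟩ := p
    obtain ⟨m, y⟩ := q
    obtain rfl : n = m := h
    rw [glueDist_mk_same]
    exact dist_triangle_right _ _ _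
  · rw [glueDist_of_ne h]
    cases u <;> simp

theorem exists_glueDist_eq {p q : OmegaPoint} (h : p.level ≠ q.level) :
    ∃ u, glueDist p q = p.poleDist u + q.poleDist u := by
  rw [glueDist_of_ne h]
  rcases min_choice (p.poleDist true + q.poleDist true) (p.poleDist false + q.poleDist false)
    with h1 | h1 <;> rw [h1]
  exacts [⟨_, rfl⟩, ⟨_, rfl⟩]

theorem glueDist_comm (p q : OmegaPoint) : glueDist p q = glueDist q p := by
  by_cases h : p.level = q.level
  · obtain ⟨n, x⟩ := p
    obtain ⟨m, y⟩ := q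
    obtain rfl : n = m := h
    rw [glueDist_mk_same, glueDist_mk_same, dist_comm]
  · rw [glueDist_of_ne h, glueDist_of_ne (Ne.symm h)]
    simp only [add_comm]

theorem poleDist_le (p q : OmegaPoint) (h : p.level = q.level) (u : Bool) :
    p.poleDist u ≤ glueDist p q + q.poleDist u := by
  obtain ⟨n, x⟩ := p
  obtain ⟨m, y⟩ := q
  obtain rfl : n = m := h
  rw [glueDist_mk_same]
  exact dist_triangle _ _ _

theorem two_le_poleDist (p : OmegaPoint) {u v : Bool} (h : u ≠ v) :
    2 ≤ p.poleDist u + p.poleDist v := by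
  have h1 := (finiteDiamond p.level).dist_top_bot
  have h2 := dist_triangle_left (finiteDiamond p.level).top (finiteDiamond p.level).bot p.pt
  cases u <;> cases v <;> simp_all [poleDist, PoledSpace.pole, add_comm]

theorem poleDist_le_add_two (p : OmegaPoint) (u v : Bool) :
    p.poleDist u ≤ p.poleDist v + 2 := by
  refine (dist_triangle _ ((finiteDiamond p.level).pole v) _).trans (add_le_add le_rfl ?_)
  have h := (finiteDiamond p.level).dist_top_bot
  cases u <;> cases v <;> simp_all [PoledSpace.pole, dist_comm]

theorem glueDist_triangle (p q r : OmegaPoint) : glueDist p r ≤ glueDist p q + glueDist q r := by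
  by_cases hpq : p.level = q.level
  · by_cases hqr : q.level = r.level
    · obtain ⟨n, x⟩ := p
      obtain ⟨m, y⟩ := q
      obtain ⟨k, z⟩ := r
      obtain rfl : n = m := hpq
      obtain rfl : n = k := hqr
      simp only [glueDist_mk_same]
      exact dist_triangle _ _ _
    · obtain ⟨u, h1⟩ := exists_glueDist_eq hqr
      have h2 := poleDist_le p q hpq u
      have h3 := glueDist_le (p := p) (q := r) u
      linarith
  · obtain ⟨u, h1⟩ := exists_glueDist_eq hpq
    by_cases hqr : q.level = r.level
    · have h2 := poleDist_le r q hqr.symm u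
      have h3 := glueDist_le (p := p) (q := r) u
      rw [glueDist_comm r q] at h2
      linarith
    · obtain ⟨v, h2⟩ := exists_glueDist_eq hqr
      have hq : 0 ≤ q.poleDist u := dist_nonneg
      rcases eq_or_ne u v with rfl | huv
      · have h3 := glueDist_le (p := p) (q := r) u
        linarith
      · have h3 := glueDist_le (p := p) (q := r) u
        have h4 := two_le_poleDist q huv
        have h5 := poleDist_le_add_two r u v
        linarith

instance : PseudoMetricSpace OmegaPoint where
  dist := glueDist
  dist_self p := by
    obtain ⟨n, x⟩ := p
    rw [glueDist_mk_same, dist_self]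
  dist_comm := glueDist_comm
  dist_triangle := glueDist_triangle

theorem dist_def (p q : OmegaPoint) : dist p q = glueDist p q := rfl

end OmegaPoint

/-- `D_ω`: all `D_n`, `1 ≤ n < ω`, glued together along their top poles and along their bottom poles,
i.e. the points at distance `0` are identified. -/
abbrev DiamondOmega : Type := SeparationQuotient OmegaPoint

/-- The base point `ℓ_ω` of `D_ω`: the first midpoint of `D₁`. -/
def DiamondOmega.base : DiamondOmega := SeparationQuotient.mk ⟨0, DiamondVertex.mid 0⟩

end

/-! Write `B` for the unit ball of the free space, and σ for the weak derivation.

Upper bound. Fix `ε` and `η` with `22 * η < ε`. Consider the functions in the unit ball of `Lip₀`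
that agree at the two poles, and the bound they satisfy on a derived set of `B`. A block of ω
derivations lowers this bound by `η` (`lt_of_mem_weakDerivedIter_add_omega0`). The zero function
keeps the bound nonnegative on a nonempty set, so finitely many blocks empty `B`, and Φ(·, ε) ≤ ω·m
for some finite `m`. For one block, suppose that such a function `F` is still almost maximal at `y`.
Since `y` is almost finitely supported, `F` may be taken supported on the diamonds of depth at most
some `n`. Pole-balanced functions living on and off these diamonds add up like an ℓ∞-sum
(`norm_add_le_of_supported`), so on the slice where `F` is almost maximal everything off them is at
most `η`. On them the points are uniformly isolated, so all bounded functions are Lipschitz and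
functionals behave like elements of ℓ₁. A point of almost maximal ℓ₁-size has a weak neighbourhood
of small diameter (`exists_isWeaklyOpen_dist_le`), so each derivation lowers that size by `η` and
finitely many suffice. Their number depends on `n`, hence on `y`, which is why a block has length ω.

Lower bound. The normalized molecule of an edge is the average of the molecules of the two halves of
the path through any midpoint. Taking the upper half through midpoint `k` and the lower half through
midpoint `l` perturbs it by a multiple of δ(l) - δ(k). Such differences accumulate weakly at 0 but
have norm bounded below, even when this is done in many copies at once
(`exists_mem_moleculeHull_one_le_dist`). Hence the molecule of the poles survives n derivations with
`ε = 1` for every n, the poles being common to all diamonds, and so lies in σ^ω. Since `B` contains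
affine copies of itself, iterating shows that σ^(ω·m) is nonempty for `ε = 3⁻ᵐ`
(`smul_mem_weakDerivedIter_omega0_mul`). Both bounds together give ω². -/

noncomputable section

/-! ### Weakly open sets and the derivation -/

section WeakDerivation

open Filter Topology

variable {X : Type*} [NormedAddCommGroup X] [NormedSpace ℝ X]

/-- A set is weakly open if its image in the weak space is open. -/
def IsWeaklyOpen (V : Set X) : Prop := IsOpen (toWeakSpace ℝ X '' V)

theorem isWeaklyOpen_iff {V : Set X} :
    IsWeaklyOpen V ↔ IsOpen ((toWeakSpace ℝ X).symm ⁻¹' V) := by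
  rw [IsWeaklyOpen]
  have : toWeakSpace ℝ X '' V = (toWeakSpace ℝ X).symm ⁻¹' V := by
    exact (toWeakSpace ℝ X).toEquiv.image_eq_preimage_symm V
  rw [this]

theorem continuous_dual_weakSpace (φ : StrongDual ℝ X) :
    Continuous fun x : WeakSpace ℝ X => φ ((toWeakSpace ℝ X).symm x) :=
  WeakBilin.eval_continuous (topDualPairing ℝ X).flip φ

theorem tendsto_toWeakSpace {ι : Type*} {l : Filter ι} {f : ι → X} {x : X}
    (h : ∀ φ : StrongDual ℝ X, Tendsto (fun i => φ (f i)) l (𝓝 (φ x))) :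
    Tendsto (fun i => toWeakSpace ℝ X (f i)) l (𝓝 (toWeakSpace ℝ X x)) := by
  have hinj : Function.Injective ((topDualPairing ℝ X).flip : X →ₗ[ℝ] _) := by
    intro a b hab
    refine (SeparatingDual.eq_iff_forall_dual_eq (R := ℝ)).2 fun φ => ?_
    exact congrArg (fun g => g φ) hab
  exact (WeakBilin.tendsto_iff_forall_eval_tendsto _ hinj).2 h

theorem IsWeaklyOpen.preimage_dual (φ : StrongDual ℝ X) {O : Set ℝ} (hO : IsOpen O) :
    IsWeaklyOpen (φ ⁻¹' O) :=
  isWeaklyOpen_iff.2 (hO.preimage (continuous_dual_weakSpace φ))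

theorem IsWeaklyOpen.inter {V W : Set X} (hV : IsWeaklyOpen V) (hW : IsWeaklyOpen W) :
    IsWeaklyOpen (V ∩ W) :=
  isWeaklyOpen_iff.2 ((isWeaklyOpen_iff.1 hV).inter (isWeaklyOpen_iff.1 hW))

theorem IsWeaklyOpen.biInter_finset {ι : Type*} (s : Finset ι) {V : ι → Set X}
    (hV : ∀ i ∈ s, IsWeaklyOpen (V i)) : IsWeaklyOpen (⋂ i ∈ s, V i) := by
  refine isWeaklyOpen_iff.2 ?_
  simp only [Set.preimage_iInter]
  exact isOpen_biInter_finset fun i hi => isWeaklyOpen_iff.1 (hV i hi)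

theorem IsWeaklyOpen.preimage_affine {V : Set X} (hV : IsWeaklyOpen V) (y : X) (c : ℝ) :
    IsWeaklyOpen ((fun z => y + c • z) ⁻¹' V) := by
  rw [isWeaklyOpen_iff] at hV ⊢
  have : Continuous fun z : WeakSpace ℝ X => toWeakSpace ℝ X y + c • z := by fun_prop
  exact hV.preimage this

/-- If `R` is a bounded sequence, the differences of its terms accumulate weakly at `0`. -/
theorem IsWeaklyOpen.exists_add_sub_mem {V : Set X} (hV : IsWeaklyOpen V) {z : X} (hz : z ∈ V)
    {R : ℕ → X} {C : ℝ} (hR : ∀ k, ‖R k‖ ≤ C) : ∃ k l, k ≠ l ∧ z + R l - R k ∈ V := by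
  -- Along a fixed nonprincipal ultrafilter every bounded scalar sequence converges, so no weakly
  -- convergent subsequence of `R` is needed.
  have hlim : ∀ φ : StrongDual ℝ X, ∃ c, Tendsto (fun k => φ (R k)) (hyperfilter ℕ) (𝓝 c) := by
    intro φ
    have hb : ∀ k, φ (R k) ∈ Metric.closedBall (0 : ℝ) (‖φ‖ * C) := fun k => by
      rw [mem_closedBall_zero_iff]
      exact φ.le_opNorm_of_le (hR k)
    have hle : ↑((hyperfilter ℕ).map fun k => φ (R k)) ≤
        𝓟 (Metric.closedBall (0 : ℝ) (‖φ‖ * C)) := by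
      rw [le_principal_iff]
      exact Filter.mem_map.2 (Filter.Eventually.of_forall hb)
    obtain ⟨c, -, hc⟩ := (isCompact_closedBall (0 : ℝ) (‖φ‖ * C)).ultrafilter_le_nhds _ hle
    exact ⟨c, hc⟩
  have ht : Tendsto (fun q : ℕ × ℕ => toWeakSpace ℝ X (z + R q.2 - R q.1))
      ((hyperfilter ℕ : Filter ℕ) ×ˢ (hyperfilter ℕ : Filter ℕ)) (𝓝 (toWeakSpace ℝ X z)) := by
    refine tendsto_toWeakSpace fun φ => ?_
    obtain ⟨c, hc⟩ := hlim φ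
    have h := ((tendsto_const_nhds (x := φ z)).add (hc.comp tendsto_snd)).sub
      (hc.comp (tendsto_fst (f := (hyperfilter ℕ : Filter ℕ)) (g := (hyperfilter ℕ : Filter ℕ))))
    simpa using h
  have hmem : ∀ᶠ q in (hyperfilter ℕ : Filter ℕ) ×ˢ (hyperfilter ℕ : Filter ℕ),
      toWeakSpace ℝ X (z + R q.2 - R q.1) ∈ toWeakSpace ℝ X '' V :=
    ht.eventually (IsOpen.mem_nhds hV ⟨z, hz, rfl⟩)
  -- `k` is fixed first; almost every `l` is then admissible, and nonprincipality allows `l ≠ k`.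
  obtain ⟨k, hk⟩ := hmem.curry.exists
  have hne : ∀ᶠ l in (hyperfilter ℕ : Filter ℕ), l ≠ k := by
    have : ({k} : Set ℕ)ᶜ ∈ hyperfilter ℕ := compl_mem_hyperfilter_of_finite (Set.finite_singleton k)
    exact this
  obtain ⟨l, hl, hlk⟩ := (hk.and hne).exists
  refine ⟨k, l, hlk.symm, ?_⟩
  obtain ⟨v, hv, hvz⟩ := hl
  rwa [← (toWeakSpace ℝ X).injective hvz]

theorem mem_weakDerivedSet_iff {ε : ℝ} {K : Set X} {x : X} :
    x ∈ weakDerivedSet ε K ↔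
      x ∈ K ∧ ∀ V, IsWeaklyOpen V → x ∈ V → ENNReal.ofReal ε ≤ Metric.ediam (V ∩ K) := by
  simp only [weakDerivedSet, Set.mem_sdiff, Set.mem_sUnion, Set.mem_ofPred_eq, not_exists, not_and,
    and_imp, IsWeaklyOpen]
  refine and_congr_right fun _ => forall_congr' fun V => ?_
  constructor
  · intro h h1 h2
    by_contra h3
    exact h h1 (not_le.1 h3) h2
  · intro h h1 h2 h3
    exact absurd (h h1 h3) (not_le.2 h2)

theorem mem_weakDerivedSet_of_forall {ε : ℝ} {K : Set X} {x : X} (hx : x ∈ K)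
    (h : ∀ V, IsWeaklyOpen V → x ∈ V → ∃ y ∈ V ∩ K, ε ≤ dist x y) :
    x ∈ weakDerivedSet ε K := by
  refine mem_weakDerivedSet_iff.2 ⟨hx, fun V hV hxV => ?_⟩
  obtain ⟨y, hy, hxy⟩ := h V hV hxV
  calc ENNReal.ofReal ε ≤ ENNReal.ofReal (dist x y) := ENNReal.ofReal_le_ofReal hxy
    _ = edist x y := (edist_dist x y).symm
    _ ≤ _ := Metric.edist_le_ediam_of_mem (s := V ∩ K) ⟨hxV, hx⟩ hy

theorem notMem_weakDerivedSet {ε η : ℝ} (hε : 0 < ε) (hη : η < ε) {K : Set X} {x : X} {V : Set X}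
    (hV : IsWeaklyOpen V) (hxV : x ∈ V) (h : ∀ y ∈ V ∩ K, ∀ z ∈ V ∩ K, dist y z ≤ η) :
    x ∉ weakDerivedSet ε K := by
  intro hx
  have h1 := (mem_weakDerivedSet_iff.1 hx).2 V hV hxV
  have h2 : Metric.ediam (V ∩ K) ≤ ENNReal.ofReal η := Metric.ediam_le fun y hy z hz => by
    rw [edist_dist]
    exact ENNReal.ofReal_le_ofReal (h y hy z hz)
  exact absurd (h1.trans h2) (not_le.2 ((ENNReal.ofReal_lt_ofReal_iff hε).2 hη))

theorem weakDerivedSet_subset (ε : ℝ) (K : Set X) : weakDerivedSet ε K ⊆ K := Set.sdiff_subset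

theorem weakDerivedIter_antitone (ε : ℝ) (K : Set X) : Antitone (weakDerivedIter ε K) := by
  intro α β hαβ
  induction β using Ordinal.limitRecOn with
  | zero => rw [nonpos_iff_eq_zero.1 hαβ]
  | add_one β ih =>
    rcases hαβ.eq_or_lt with rfl | h
    · exact le_rfl
    · rw [weakDerivedIter_add_one]
      exact (weakDerivedSet_subset _ _).trans (ih (Order.lt_add_one_iff.1 h))
  | limit β hβ ih =>
    rcases hαβ.eq_or_lt with rfl | h
    · exact le_rfl
    · rw [weakDerivedIter_limit _ _ _ hβ]
      exact Set.iInter₂_subset α h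

theorem weakDerivedIter_add (ε : ℝ) (K : Set X) (α β : Ordinal) :
    weakDerivedIter ε K (α + β) = weakDerivedIter ε (weakDerivedIter ε K α) β := by
  induction β using Ordinal.limitRecOn with
  | zero => rw [add_zero, weakDerivedIter_zero]
  | add_one β ih => rw [← add_assoc, weakDerivedIter_add_one, weakDerivedIter_add_one, ih]
  | limit β hβ ih =>
    rw [weakDerivedIter_limit _ _ _ (Ordinal.isSuccLimit_add α hβ), weakDerivedIter_limit _ _ _ hβ]
    ext x
    simp only [Set.mem_iInter]
    constructor
    · intro h γ hγ
      rw [← ih γ hγ]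
      exact h _ (add_lt_add_right hγ α)
    · intro h γ hγ
      -- The ordinals `α + γ'` with `γ' < β` are cofinal in `α + β`, so they determine the
      -- intersection.
      obtain ⟨γ', hγ', hle⟩ := (Ordinal.lt_add_iff hβ.bot_lt.ne').1 hγ
      refine weakDerivedIter_antitone ε K hle ?_
      rw [ih γ' hγ']
      exact h γ' hγ'

/-- Derived sets of a set containing an affine image of `K`. -/
theorem affine_mem_weakDerivedIter {K K' : Set X} {y : X} {c ε ε' : ℝ} (hc : 0 < c)
    (hε : ε' ≤ c * ε) (hK : ∀ z ∈ K, y + c • z ∈ K') (α : Ordinal) :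
    ∀ z ∈ weakDerivedIter ε K α, y + c • z ∈ weakDerivedIter ε' K' α := by
  induction α using Ordinal.limitRecOn with
  | zero => simpa only [weakDerivedIter_zero] using hK
  | add_one α ih =>
    intro z hz
    rw [weakDerivedIter_add_one, mem_weakDerivedSet_iff] at hz ⊢
    refine ⟨ih z hz.1, fun V hV hzV => ?_⟩
    have h := hz.2 _ (hV.preimage_affine y c) hzV
    have h2 : Metric.ediam ((fun z => y + c • z) ⁻¹' V ∩ weakDerivedIter ε K α) ≤
        (ENNReal.ofReal c)⁻¹ * Metric.ediam (V ∩ weakDerivedIter ε' K' α) := by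
      refine Metric.ediam_le fun a ha b hb => ?_
      have h3 : edist (y + c • a) (y + c • b) ≤ Metric.ediam (V ∩ weakDerivedIter ε' K' α) :=
        Metric.edist_le_ediam_of_mem ⟨ha.1, ih a ha.2⟩ ⟨hb.1, ih b hb.2⟩
      have h4 : edist (y + c • a) (y + c • b) = ENNReal.ofReal c * edist a b := by
        rw [edist_dist, edist_dist, dist_add_left, dist_smul₀, Real.norm_of_nonneg hc.le,
          ENNReal.ofReal_mul hc.le]
      rw [h4] at h3
      have hc0 : ENNReal.ofReal c ≠ 0 := by simpa using hc
      calc edist a b = (ENNReal.ofReal c)⁻¹ * (ENNReal.ofReal c * edist a b) := by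
            rw [← mul_assoc, ENNReal.inv_mul_cancel hc0 ENNReal.ofReal_ne_top, one_mul]
        _ ≤ _ := by gcongr
    have hc0 : ENNReal.ofReal c ≠ 0 := by simpa using hc
    calc ENNReal.ofReal ε' ≤ ENNReal.ofReal (c * ε) := ENNReal.ofReal_le_ofReal hε
      _ = ENNReal.ofReal c * ENNReal.ofReal ε := ENNReal.ofReal_mul hc.le
      _ ≤ ENNReal.ofReal c *
          ((ENNReal.ofReal c)⁻¹ * Metric.ediam (V ∩ weakDerivedIter ε' K' α)) := by
            gcongr; exact h.trans h2
      _ = _ := by rw [← mul_assoc, ENNReal.mul_inv_cancel hc0 ENNReal.ofReal_ne_top, one_mul]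
  | limit α hα ih =>
    intro z hz
    rw [weakDerivedIter_limit _ _ _ hα, Set.mem_iInter₂] at hz ⊢
    exact fun β hβ => ih β hβ z (hz β hβ)

open Ordinal in
universe v in
/-- If `σ_ε^ω(B_X)` is nonempty then no `σ_{ε'}^{ω m}(B_X)` is empty for `ε'` small enough. -/
theorem smul_mem_weakDerivedIter_omega0_mul {w : X} {ε : ℝ} (hε : 0 ≤ ε)
    (hw : w ∈ weakDerivedIter ε (Metric.closedBall (0 : X) 1) (ω : Ordinal.{v})) (m : ℕ) :
    ∀ x ∈ Metric.closedBall (0 : X) 1, ((1 / 3 : ℝ) ^ m) • x ∈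
      weakDerivedIter ((1 / 3 : ℝ) ^ m * ε) (Metric.closedBall (0 : X) 1) (ω * m : Ordinal.{v}) := by
  have hwB : w ∈ Metric.closedBall (0 : X) 1 := by
    have := weakDerivedIter_antitone ε (Metric.closedBall (0 : X) 1) (zero_le : (0 : Ordinal.{v}) ≤ ω) hw
    rwa [weakDerivedIter_zero] at this
  rw [mem_closedBall_zero_iff] at hwB
  induction m with
  | zero =>
    intro x hx
    simpa [weakDerivedIter_zero] using hx
  | succ m ih =>
    intro x hx
    have hx' := mem_closedBall_zero_iff.1 hx
    set q : ℝ := (1 / 3 : ℝ) ^ m with hq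
    have hq0 : 0 < q := by positivity
    have hq1 : (1 / 3 : ℝ) ^ (m + 1) = q * (1 / 3) := by rw [pow_succ]
    rw [hq1]
    have hcast : (ω * ((m + 1 : ℕ) : Ordinal.{v})) = ω * m + ω := by
      rw [Nat.cast_add_one, mul_add_one]
    rw [hcast, weakDerivedIter_add]
    -- The copy of the ball centred at `(q / 3) • (x - w)` fits into the ball of radius `q` because
    -- `‖x - w‖ + ‖z‖ ≤ 3`; this is the origin of `1 / 3`. Its point corresponding to `w` is `(q /
    -- 3) • x`.
    have key : ∀ z ∈ Metric.closedBall (0 : X) 1, (q * (1 / 3)) • (x - w) + (q * (1 / 3)) • z ∈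
        weakDerivedIter (q * (1 / 3) * ε) (Metric.closedBall (0 : X) 1) (ω * m) := by
      intro z hz
      have hz' := mem_closedBall_zero_iff.1 hz
      have h1 : (1 / 3 : ℝ) • (x - w) + (1 / 3 : ℝ) • z ∈ Metric.closedBall (0 : X) 1 := by
        rw [mem_closedBall_zero_iff, ← smul_add, norm_smul]
        have h2 := norm_add_le (x - w) z
        have h3 := norm_sub_le x w
        rw [Real.norm_of_nonneg (by norm_num)]
        linarith
      have h2 := ih _ h1
      have h3 := affine_mem_weakDerivedIter (K := Metric.closedBall (0 : X) 1)
        -- The identity map is used here only to pass to the smaller `ε`.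
        (K' := Metric.closedBall (0 : X) 1) (y := 0) (c := 1) (ε := q * ε)
        (ε' := q * (1 / 3) * ε) one_pos (by nlinarith [mul_nonneg hq0.le hε]) (fun z hz => by simpa using hz) _ _ h2
      rw [zero_add, one_smul, smul_add, smul_smul, smul_smul] at h3
      exact h3
    have h := affine_mem_weakDerivedIter (by positivity) le_rfl key ω w hw
    rwa [← smul_add, sub_add_cancel] at h

end WeakDerivation

/-! ### Elements of `Lip₀(M)` and functionals on the Lipschitz-free space -/

section LipZeroConstructions

variable {M : Type*} [MetricSpace M] {x₀ : M}

/-- The element of `Lip₀(M)` obtained from a Lipschitz function by subtracting a constant. -/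
def LipZero.ofFun (x₀ : M) (f : M → ℝ) (C : ℝ) (h : ∀ x y, |f x - f y| ≤ C * dist x y) :
    LipZero M x₀ :=
  (⟨fun x => f x - f x₀, sub_self _, Real.toNNReal C, LipschitzWith.of_dist_le_mul fun x y => by
    rw [Real.dist_eq, sub_sub_sub_cancel_right]
    refine (h x y).trans (mul_le_mul_of_nonneg_right (Real.le_coe_toNNReal C) dist_nonneg)⟩ :
    lipZeroSubmodule M x₀)

theorem LipZero.ofFun_sub {f : M → ℝ} {C : ℝ} (h : ∀ x y, |f x - f y| ≤ C * dist x y) (x y : M) :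
    LipZero.ofFun x₀ f C h x - LipZero.ofFun x₀ f C h y = f x - f y :=
  sub_sub_sub_cancel_right _ _ _

theorem LipZero.norm_ofFun_le {f : M → ℝ} {C : ℝ} (hC : 0 ≤ C)
    (h : ∀ x y, |f x - f y| ≤ C * dist x y) : ‖LipZero.ofFun x₀ f C h‖ ≤ C :=
  LipZero.norm_le_of_forall hC fun x y => by rw [LipZero.ofFun_sub]; exact h x y

theorem LipZero.sub_apply (F G : LipZero M x₀) (x : M) : (F - G) x = F x - G x := rfl

theorem LipZero.sum_apply {ι : Type*} (s : Finset ι) (F : ι → LipZero M x₀) (x : M) :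
    (∑ i ∈ s, F i) x = ∑ i ∈ s, F i x :=
  map_sum (lipDelta x₀ x) F s

/-- Functions are handled through their differences with the value at a pole, so the base point
plays no role; vanishing at `x₀` fixes the constant. -/
theorem LipZero.eq_of_sub_eq {F G : LipZero M x₀} (t : M) (h : ∀ x, F x - F t = G x - G t) :
    F = G := by
  have h0 := h x₀
  rw [F.apply_base, G.apply_base] at h0
  ext x
  linarith [h x]

theorem LipZero.abs_sub_le_dist {F : LipZero M x₀} (hF : ‖F‖ ≤ 1) (x y : M) :
    |F x - F y| ≤ dist x y :=
  (F.abs_sub_le x y).trans (mul_le_of_le_one_left dist_nonneg hF)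

theorem lipDelta_apply (x : M) (F : LipZero M x₀) : lipDelta x₀ x F = F x := rfl

/-- The functional on the Lipschitz-free space given by an element of `Lip₀(M)`. -/
def freeEval (F : LipZero M x₀) : StrongDual ℝ (lipschitzFree M x₀) :=
  (ContinuousLinearMap.apply ℝ ℝ F).comp (lipschitzFree M x₀).subtypeL

theorem free_apply_le (y : lipschitzFree M x₀) (hy : ‖y‖ ≤ 1) (F : LipZero M x₀) :
    y.1 F ≤ ‖F‖ :=
  (le_abs_self _).trans ((y.1.le_opNorm F).trans (mul_le_of_le_one_left (norm_nonneg _) hy))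

/-- Elements of the Lipschitz-free space are almost finitely supported. -/
theorem exists_finset_abs_apply_le (t : M) (y : lipschitzFree M x₀) {η : ℝ} (hη : 0 < η) :
    ∃ A : Finset M, ∀ F : LipZero M x₀, (∀ a ∈ A, F a = F t) → |y.1 F| ≤ η * ‖F‖ := by
  classical
  have hspan : ∀ z ∈ Submodule.span ℝ (Set.range (lipDelta x₀)),
      ∃ A : Finset M, ∀ F : LipZero M x₀, (∀ a ∈ A, F a = 0) → z F = 0 := by
    intro z hz
    induction hz using Submodule.span_induction with
    | mem z hz =>
      obtain ⟨x, rfl⟩ := hz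
      exact ⟨{x}, fun F hF => hF x (Finset.mem_singleton_self x)⟩
    | zero => exact ⟨∅, fun F _ => rfl⟩
    | add z w _ _ hz hw =>
      obtain ⟨A, hA⟩ := hz
      obtain ⟨B, hB⟩ := hw
      refine ⟨A ∪ B, fun F hF => ?_⟩
      rw [_root_.add_apply, hA F fun a ha => hF a (Finset.mem_union_left _ ha),
        hB F fun a ha => hF a (Finset.mem_union_right _ ha), add_zero]
    | smul c z _ hz =>
      obtain ⟨A, hA⟩ := hz
      exact ⟨A, fun F hF => by rw [_root_.smul_apply, hA F hF, smul_zero]⟩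
  have hy : y.1 ∈ closure (Submodule.span ℝ (Set.range (lipDelta x₀)) : Set _) := y.2
  obtain ⟨z, hz, hyz⟩ := Metric.mem_closure_iff.1 hy η hη
  obtain ⟨A, hA⟩ := hspan z hz
  -- With `x₀` in the set, being equal to `F t` there forces `F t = 0`, which turns "constant on the
  -- set" into "zero on the set".
  refine ⟨insert x₀ A, fun F hF => ?_⟩
  have ht : F t = 0 := by rw [← hF x₀ (Finset.mem_insert_self _ _), F.apply_base]
  have hzF : z F = 0 := hA F fun a ha => by rw [hF a (Finset.mem_insert_of_mem ha), ht]
  have h : y.1 F = (y.1 - z) F := by rw [_root_.sub_apply, hzF, sub_zero]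
  rw [h, ← Real.norm_eq_abs]
  refine ((y.1 - z).le_opNorm F).trans (mul_le_mul_of_nonneg_right ?_ (norm_nonneg _))
  rw [← dist_eq_norm]
  exact hyz.le

end LipZeroConstructions

/-! ### Spaces glued along two poles -/

/-- An exhaustion of the complement of two poles `t`, `b` by sets `L n` of uniformly isolated
points, such that every path leaving `L n` passes through a pole. -/
structure PoleExhaustion (M : Type*) [MetricSpace M] where
  t : M
  b : M
  L : ℕ → Set M
  dist_poles : dist t b = 2
  mono : Monotone L
  cover : ∀ x, x ≠ t → x ≠ b → ∃ n, x ∈ L n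
  top_notMem : ∀ n, t ∉ L n
  bot_notMem : ∀ n, b ∉ L n
  separated : ∀ n, ∃ δ > 0, ∀ x ∈ L n, ∀ y, y ≠ x → δ ≤ dist x y
  dist_top_le : ∀ n, ∀ x ∈ L n, dist x t ≤ 2
  cross : ∀ n, ∀ x ∈ L n, ∀ y ∉ L n,
    dist x t + dist t y ≤ dist x y ∨ dist x b + dist b y ≤ dist x y

namespace PoleExhaustion

variable {M : Type*} [MetricSpace M] {x₀ : M} (E : PoleExhaustion M)

/-- The functions in the unit ball of `Lip₀(M)` taking the same value at both poles. -/
def IsPoleBalanced (F : LipZero M x₀) : Prop := ‖F‖ ≤ 1 ∧ F E.t = F E.b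

/-- The functions that are supported on `L n`, up to a constant. -/
def SupportedOn (n : ℕ) (F : LipZero M x₀) : Prop := ∀ x ∉ E.L n, F x = F E.t

/-- The functions that are supported off `L n`, up to a constant. -/
def SupportedOff (n : ℕ) (F : LipZero M x₀) : Prop := ∀ x ∈ E.L n, F x = F E.t

/-- The functions that are supported on `L n` and bounded by `1`, up to a constant. -/
def IsLocalUnit (n : ℕ) (F : LipZero M x₀) : Prop :=
  E.SupportedOn n F ∧ ∀ x, |F x - F E.t| ≤ 1

variable {E} {n : ℕ}

/-- A shortest path from `x` to `y` passes through a pole, where both `F - F t` and `G - G t`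
vanish; each term is bounded by its own leg of the path. -/
theorem abs_add_abs_le_of_mem_of_notMem {F G : LipZero M x₀} {C : ℝ} (hF : ‖F‖ ≤ C) (hG : ‖G‖ ≤ C)
    (hFt : F E.t = F E.b) (hGt : G E.t = G E.b) {x y : M} (hx : x ∈ E.L n) (hy : y ∉ E.L n) :
    |F x - F E.t| + |G y - G E.t| ≤ C * dist x y := by
  have hC : 0 ≤ C := (norm_nonneg _).trans hF
  have key : ∀ u, F u = F E.t → G u = G E.t → dist x u + dist u y ≤ dist x y →
      |F x - F E.t| + |G y - G E.t| ≤ C * dist x y := by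
    intro u h1 h2 h
    rw [← h1, ← h2]
    have h3 := (F.abs_sub_le x u).trans (mul_le_mul_of_nonneg_right hF dist_nonneg)
    have h4 := (G.abs_sub_le y u).trans (mul_le_mul_of_nonneg_right hG dist_nonneg)
    rw [dist_comm y u] at h4
    have h5 := mul_le_mul_of_nonneg_left h hC
    linarith
  rcases E.cross n x hx y hy with h | h
  · exact key E.t rfl rfl h
  · exact key E.b hFt.symm hGt.symm h

/-- The two parts form an ℓ∞-sum: slopes within one part see a single summand, and slopes across
pass through a pole. -/
theorem norm_add_le_of_supported {F G : LipZero M x₀} {C : ℝ} (hF : ‖F‖ ≤ C) (hG : ‖G‖ ≤ C)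
    (hFt : F E.t = F E.b) (hGt : G E.t = G E.b) (hFn : E.SupportedOn n F)
    (hGn : E.SupportedOff n G) : ‖F + G‖ ≤ C := by
  have hC : 0 ≤ C := (norm_nonneg _).trans hF
  have hFxy := fun x y => (F.abs_sub_le x y).trans (mul_le_mul_of_nonneg_right hF dist_nonneg)
  have hGxy := fun x y => (G.abs_sub_le x y).trans (mul_le_mul_of_nonneg_right hG dist_nonneg)
  have hmix : ∀ x ∈ E.L n, ∀ y ∉ E.L n, |(F x + G x) - (F y + G y)| ≤ C * dist x y := by
    intro x hx y hy
    rw [hFn y hy, hGn x hx]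
    have h := abs_add_abs_le_of_mem_of_notMem hF hG hFt hGt hx hy
    have h2 := abs_sub (F x - F E.t) (G y - G E.t)
    have h3 : F x + G E.t - (F E.t + G y) = (F x - F E.t) - (G y - G E.t) := by ring
    rw [h3]
    exact h2.trans h
  refine LipZero.norm_le_of_forall hC fun x y => ?_
  rw [LipZero.add_apply, LipZero.add_apply]
  by_cases hx : x ∈ E.L n <;> by_cases hy : y ∈ E.L n
  · rw [hGn x hx, hGn y hy, add_sub_add_right_eq_sub]
    exact hFxy x y
  · exact hmix x hx y hy
  · rw [abs_sub_comm, dist_comm]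
    exact hmix y hy x hx
  · rw [hFn x hx, hFn y hy, add_sub_add_left_eq_sub]
    exact hGxy x y

/-- The pieces are the restrictions of `F - F t` to `L n` and to its complement. Cutting is free
because every crossing path meets a zero of `F - F t`. -/
theorem exists_cut {F : LipZero M x₀} (hFt : F E.t = F E.b) (n : ℕ) :
    ∃ G H : LipZero M x₀, F = G + H ∧ ‖G‖ ≤ ‖F‖ ∧ ‖H‖ ≤ ‖F‖ ∧ E.SupportedOn n G ∧
      E.SupportedOff n H := by
  classical
  have hmix : ∀ x ∈ E.L n, ∀ y ∉ E.L n, |F x - F E.t| + |F y - F E.t| ≤ ‖F‖ * dist x y :=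
    fun x hx y hy => abs_add_abs_le_of_mem_of_notMem le_rfl le_rfl hFt hFt hx hy
  have hon : ∀ x y, |(E.L n).indicator (fun z => F z - F E.t) x -
      (E.L n).indicator (fun z => F z - F E.t) y| ≤ ‖F‖ * dist x y := by
    intro x y
    by_cases hx : x ∈ E.L n <;> by_cases hy : y ∈ E.L n <;> simp only [hx, hy,
      Set.indicator_of_mem, Set.indicator_of_notMem, not_false_eq_true, sub_zero, zero_sub, abs_neg,
      sub_sub_sub_cancel_right]
    · exact F.abs_sub_le x y
    · linarith [hmix x hx y hy, abs_nonneg (F y - F E.t)]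
    · rw [dist_comm]
      linarith [hmix y hy x hx, abs_nonneg (F x - F E.t)]
    · simpa using mul_nonneg (norm_nonneg F) dist_nonneg
  have hoff : ∀ x y, |(E.L n)ᶜ.indicator (fun z => F z - F E.t) x -
      (E.L n)ᶜ.indicator (fun z => F z - F E.t) y| ≤ ‖F‖ * dist x y := by
    intro x y
    by_cases hx : x ∈ E.L n <;> by_cases hy : y ∈ E.L n <;> simp only [hx, hy, Set.mem_compl_iff,
      Set.indicator_of_mem, Set.indicator_of_notMem, not_false_eq_true, not_true_eq_false, sub_zero,
      zero_sub, abs_neg, sub_sub_sub_cancel_right]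
    · simpa using mul_nonneg (norm_nonneg F) dist_nonneg
    · linarith [hmix x hx y hy, abs_nonneg (F x - F E.t)]
    · rw [dist_comm]
      linarith [hmix y hy x hx, abs_nonneg (F y - F E.t)]
    · exact F.abs_sub_le x y
  have ht := E.top_notMem n
  refine ⟨LipZero.ofFun x₀ _ _ hon, LipZero.ofFun x₀ _ _ hoff, ?_,
    LipZero.norm_ofFun_le (norm_nonneg F) hon, LipZero.norm_ofFun_le (norm_nonneg F) hoff, ?_, ?_⟩
  · refine LipZero.eq_of_sub_eq E.t fun x => ?_
    rw [LipZero.add_apply, LipZero.add_apply, add_sub_add_comm, LipZero.ofFun_sub,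
      LipZero.ofFun_sub]
    by_cases hx : x ∈ E.L n <;> simp [hx, ht]
  · intro x hx
    rw [← sub_eq_zero, LipZero.ofFun_sub]
    simp [hx, ht]
  · intro x hx
    rw [← sub_eq_zero, LipZero.ofFun_sub]
    simp [hx, ht]

theorem SupportedOn.top_eq_bot {F : LipZero M x₀} (hF : E.SupportedOn n F) : F E.t = F E.b :=
  (hF E.b (E.bot_notMem n)).symm

-- Points of `L n` are `δ`-isolated, so any function bounded by 1 and vanishing off `L n` is `2 /
-- δ`-Lipschitz. Thus the local units form the unit ball of ℓ∞ over `L n`, in an equivalent norm.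
variable (E) in
theorem exists_norm_le_of_isLocalUnit (x₀ : M) (n : ℕ) :
    ∃ C > 0, (∀ F : LipZero M x₀, E.IsLocalUnit n F → ‖F‖ ≤ C) ∧
      ∀ f : M → ℝ, (∀ x ∉ E.L n, f x = 0) → (∀ x, |f x| ≤ 1) →
        ∃ F : LipZero M x₀, E.IsLocalUnit n F ∧ ∀ x, F x - F E.t = f x := by
  obtain ⟨δ, hδ, hsep⟩ := E.separated n
  have hlip : ∀ f : M → ℝ, (∀ x ∉ E.L n, f x = 0) → (∀ x, |f x| ≤ 1) →
      ∀ x y, |f x - f y| ≤ 2 / δ * dist x y := by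
    intro f hf hf1 x y
    rcases eq_or_ne x y with rfl | hxy
    · simp
    have h2 : δ ≤ dist x y → |f x - f y| ≤ 2 / δ * dist x y := fun h => by
      have h3 : 2 / δ * δ ≤ 2 / δ * dist x y := mul_le_mul_of_nonneg_left h (by positivity)
      rw [div_mul_cancel₀ _ hδ.ne'] at h3
      linarith [abs_sub (f x) (f y), hf1 x, hf1 y]
    by_cases hx : x ∈ E.L n
    · exact h2 (hsep x hx y hxy.symm)
    by_cases hy : y ∈ E.L n
    · exact h2 (dist_comm y x ▸ hsep y hy x hxy)
    · rw [hf x hx, hf y hy, sub_zero, abs_zero]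
      positivity
  refine ⟨2 / δ, by positivity, fun F hF => ?_, fun f hf hf1 => ?_⟩
  · refine LipZero.norm_le_of_forall (by positivity) fun x y => ?_
    have := hlip (fun x => F x - F E.t) (fun x hx => sub_eq_zero.2 (hF.1 x hx)) hF.2 x y
    rwa [sub_sub_sub_cancel_right] at this
  · have h := hlip f hf hf1
    have ht := hf E.t (E.top_notMem n)
    refine ⟨LipZero.ofFun x₀ f _ h, ⟨fun x hx => ?_, fun x => ?_⟩, fun x => ?_⟩
    · rw [← sub_eq_zero, LipZero.ofFun_sub, hf x hx, ht, sub_zero]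
    · rw [LipZero.ofFun_sub, ht, sub_zero]
      exact hf1 x
    · rw [LipZero.ofFun_sub, ht, sub_zero]

theorem IsLocalUnit.neg {F : LipZero M x₀} (hF : E.IsLocalUnit n F) : E.IsLocalUnit n (-F) := by
  refine ⟨fun x hx => ?_, fun x => ?_⟩
  · change -F x = -F E.t
    rw [hF.1 x hx]
  · change |-F x - -F E.t| ≤ 1
    rw [neg_sub_neg, abs_sub_comm]
    exact hF.2 x

end PoleExhaustion

theorem norm_le_one_of_mem_closedBall {X : Type*} [NormedAddCommGroup X] {y : X}
    (hy : y ∈ Metric.closedBall (0 : X) 1) : ‖y‖ ≤ 1 :=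
  mem_closedBall_zero_iff.1 hy

/-! ### The upper bound: each block of ω derivations costs a fixed amount -/

namespace PoleExhaustion

open scoped Ordinal

variable {M : Type*} [MetricSpace M] {x₀ : M} {E : PoleExhaustion M} {n : ℕ}

/-- The part of a local unit carried by a finite set `A`. -/
theorem IsLocalUnit.exists_split {F : LipZero M x₀} (hF : E.IsLocalUnit n F) (A : Finset M) :
    ∃ G H : LipZero M x₀, F = G + H ∧ E.IsLocalUnit n G ∧ E.IsLocalUnit n H ∧
      (∀ x, G x - G E.t = (A : Set M).indicator (fun z => F z - F E.t) x) ∧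
      (∀ x, H x - H E.t = (A : Set M)ᶜ.indicator (fun z => F z - F E.t) x) := by
  classical
  obtain ⟨C, -, -, hex⟩ := E.exists_norm_le_of_isLocalUnit x₀ n
  have hind : ∀ S : Set M, ∃ G : LipZero M x₀, E.IsLocalUnit n G ∧
      ∀ x, G x - G E.t = S.indicator (fun z => F z - F E.t) x := by
    intro S
    refine hex _ (fun x hx => ?_) (fun x => ?_)
    · by_cases h : x ∈ S <;> simp [h, hF.1 x hx]
    · by_cases h : x ∈ S <;> simp [h, hF.2 x]
  obtain ⟨G, hG, hGx⟩ := hind A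
  obtain ⟨H, hH, hHx⟩ := hind (A : Set M)ᶜ
  refine ⟨G, H, LipZero.eq_of_sub_eq E.t fun x => ?_, hG, hH, hGx, hHx⟩
  rw [LipZero.add_apply, LipZero.add_apply, add_sub_add_comm, hGx, hHx]
  by_cases h : x ∈ A <;> simp [h]

/-- After a multiple of a fixed function is removed, a function in the unit ball decomposes as a
multiple of a local unit and a function supported off `L n`. -/
theorem exists_decomposition (E : PoleExhaustion M) (x₀ : M) (n : ℕ) :
    ∃ g : LipZero M x₀, ∀ H : LipZero M x₀, ‖H‖ ≤ 1 → ∃ (c : ℝ) (F G : LipZero M x₀), |c| ≤ 1 ∧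
      E.IsLocalUnit n F ∧ ‖G‖ ≤ 1 ∧ G E.t = G E.b ∧ E.SupportedOff n G ∧
      H = c • g + (2 : ℝ) • G + (4 : ℝ) • F := by
  -- The function `g` is 1-Lipschitz and attains slope 1 between the poles, so a multiple `c • g`
  -- with `|c| ≤ 1` absorbs the difference of `H` at the poles.
  have hlip : ∀ x y, |(dist x E.b - dist x E.t) / 2 - (dist y E.b - dist y E.t) / 2| ≤
      1 * dist x y := by
    intro x y
    have h1 := abs_dist_sub_le x y E.b
    have h2 := abs_dist_sub_le x y E.t
    rw [abs_le] at *
    constructor <;> linarith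
  refine ⟨LipZero.ofFun x₀ _ 1 hlip, fun H hH => ?_⟩
  set g := LipZero.ofFun x₀ _ 1 hlip with hg
  have hg1 : ‖g‖ ≤ 1 := LipZero.norm_ofFun_le zero_le_one hlip
  have hgtb : g E.t - g E.b = 2 := by
    rw [hg, LipZero.ofFun_sub, dist_self, dist_self, dist_comm E.b, E.dist_poles]
    norm_num
  set c := (H E.t - H E.b) / 2 with hc
  have hc1 : |c| ≤ 1 := by
    have h := LipZero.abs_sub_le_dist hH E.t E.b
    rw [E.dist_poles] at h
    rw [hc, abs_div, abs_two]
    linarith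
  set K := (1 / 2 : ℝ) • (H - c • g) with hK
  have hK1 : ‖K‖ ≤ 1 := by
    have h1 := norm_sub_le H (c • g)
    have h2 : ‖c • g‖ ≤ 1 := by
      rw [norm_smul, Real.norm_eq_abs]
      nlinarith [abs_nonneg c, norm_nonneg g]
    rw [hK, norm_smul, Real.norm_of_nonneg (by norm_num)]
    linarith
  have hKtb : K E.t = K E.b := by
    simp only [hK, LipZero.smul_apply, LipZero.sub_apply]
    rw [hc]
    have : H E.t - H E.b = (H E.t - H E.b) / 2 * (g E.t - g E.b) := by rw [hgtb]; ring
    linarith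
  obtain ⟨F, G, hFG, hF, hG, hFn, hGn⟩ := exists_cut (E := E) hKtb n
  have hGtb : G E.t = G E.b := by
    have h1 := hFn.top_eq_bot
    have h2 := hKtb
    rw [hFG, LipZero.add_apply, LipZero.add_apply] at h2
    linarith
  -- `F` is 1-Lipschitz and points of `L n` lie within 2 of the top pole, so half of `F` is a local
  -- unit. Together with the factor 2 in `H - c • g = 2 • K` this gives the coefficient 4.
  refine ⟨c, (1 / 2 : ℝ) • F, G, hc1, ⟨fun x hx => ?_, fun x => ?_⟩, hG.trans hK1, hGtb, hGn, ?_⟩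
  · rw [LipZero.smul_apply, LipZero.smul_apply, hFn x hx]
  · refine (congrArg abs (mul_sub (1 / 2 : ℝ) (F x) (F E.t)).symm).le.trans ?_
    rw [abs_mul]
    by_cases hx : x ∈ E.L n
    · have h1 := LipZero.abs_sub_le_dist (hF.trans hK1) x E.t
      have h2 := E.dist_top_le n x hx
      rw [abs_of_nonneg (by norm_num : (0 : ℝ) ≤ 1 / 2)]
      linarith
    · rw [hFn x hx, sub_self, abs_zero, mul_zero]
      exact zero_le_one
  · have h : H = c • g + (2 : ℝ) • K := by
      rw [hK, smul_smul]
      norm_num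
    rw [h, hFG, smul_add, smul_smul, add_comm ((2 : ℝ) • F), ← add_assoc]
    norm_num

/-- If the local units are almost maximal at `y₀`, then `y₀` has a weak neighbourhood of small
diameter. -/
theorem exists_isWeaklyOpen_dist_le {S : Set (lipschitzFree M x₀)} {ρ η : ℝ} (hη : 0 < η)
    (hoff : ∀ y ∈ S, ∀ H : LipZero M x₀, ‖H‖ ≤ 1 → H E.t = H E.b → E.SupportedOff n H → y.1 H ≤ η)
    (hon : ∀ y ∈ S, ∀ F : LipZero M x₀, E.IsLocalUnit n F → y.1 F ≤ ρ)
    (y₀ : lipschitzFree M x₀) {F₀ : LipZero M x₀} (hF₀ : E.IsLocalUnit n F₀)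
    (hy₀ : ρ - η < y₀.1 F₀) :
    ∃ V, IsWeaklyOpen V ∧ y₀ ∈ V ∧ ∀ y ∈ V ∩ S, ∀ z ∈ V ∩ S, dist y z ≤ 22 * η := by
  classical
  obtain ⟨C, hC, hnorm, hex⟩ := E.exists_norm_le_of_isLocalUnit x₀ n
  -- The tolerance is chosen so that the part of `F₀` off `A` contributes at most half of the gap
  -- `y₀ F₀ - (ρ - η)`; the part `P` on `A` then remains almost maximal.
  obtain ⟨A, hA⟩ := exists_finset_abs_apply_le E.t y₀
    (div_pos (sub_pos.2 hy₀) (mul_pos two_pos hC))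
  obtain ⟨P, Q, hPQ, hP, hQ, hPx, hQx⟩ := hF₀.exists_split A
  have hy₀P : ρ - η < y₀.1 P := by
    have h1 : |y₀.1 Q| ≤ (y₀.1 F₀ - (ρ - η)) / (2 * C) * C := by
      refine (hA Q fun a ha => ?_).trans (mul_le_mul_of_nonneg_left (hnorm Q hQ) ?_)
      · rw [← sub_eq_zero, hQx]
        simp [ha]
      · have := sub_pos.2 hy₀
        positivity
    have h2 : (y₀.1 F₀ - (ρ - η)) / (2 * C) * C = (y₀.1 F₀ - (ρ - η)) / 2 := by field_simp
    have h3 : y₀.1 F₀ = y₀.1 P + y₀.1 Q := by rw [← map_add, ← hPQ]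
    rw [h2] at h1
    linarith [le_abs_self (y₀.1 Q)]
  have hpoint : ∀ v : M, ∃ e : LipZero M x₀, v ∈ E.L n → ∀ x, e x - e E.t = if x = v then 1 else 0 := by
    intro v
    by_cases hv : v ∈ E.L n
    · obtain ⟨e, -, he⟩ := hex (fun x => if x = v then 1 else 0)
        (fun x hx => if_neg fun h : x = v => hx (h ▸ hv)) (fun x => by split_ifs <;> simp)
      exact ⟨e, fun _ => he⟩
    · exact ⟨0, fun h => absurd h hv⟩
  choose e he using hpoint
  obtain ⟨g, hg⟩ := exists_decomposition E x₀ n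
  set B := A.filter (· ∈ E.L n) with hB
  have hcard : (0 : ℝ) < B.card + 1 := by positivity
  -- The tolerance `η` is shared among the coordinates in `B`; the `+ 1` keeps the denominator
  -- nonzero.
  set η' := η / (B.card + 1) with hη'
  have hη'0 : 0 < η' := by positivity
  have hη'mul : (B.card + 1) * η' = η := by rw [hη']; field_simp
  refine ⟨(freeEval P ⁻¹' Set.Ioi (ρ - η) ∩ freeEval g ⁻¹' Metric.ball (y₀.1 g) η) ∩
    ⋂ v ∈ B, freeEval (e v) ⁻¹' Metric.ball (y₀.1 (e v)) η', ?_, ?_, ?_⟩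
  · exact ((IsWeaklyOpen.preimage_dual _ isOpen_Ioi).inter
      (IsWeaklyOpen.preimage_dual _ Metric.isOpen_ball)).inter
      (IsWeaklyOpen.biInter_finset _ fun v _ => IsWeaklyOpen.preimage_dual _ Metric.isOpen_ball)
  · refine ⟨⟨hy₀P, Metric.mem_ball_self hη⟩, Set.mem_iInter₂.2 fun v _ => Metric.mem_ball_self hη'0⟩
  rintro y ⟨⟨⟨hyP, hyg⟩, hye⟩, hyS⟩ z ⟨⟨⟨hzP, hzg⟩, hze⟩, hzS⟩
  replace hyP : ρ - η < y.1 P := hyP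
  replace hzP : ρ - η < z.1 P := hzP
  have hclose : ∀ {a b c r : ℝ}, dist a c < r → dist b c < r → |a - b| ≤ 2 * r := by
    intro a b c r h1 h2
    rw [Real.dist_eq, abs_lt] at h1 h2
    rw [abs_le]
    constructor <;> linarith [h1.1, h1.2, h2.1, h2.2]
  have hgyz : |y.1 g - z.1 g| ≤ 2 * η := hclose hyg hzg
  have heyz : ∀ v ∈ B, |y.1 (e v) - z.1 (e v)| ≤ 2 * η' := fun v hv =>
    hclose (Set.mem_iInter₂.1 hye v hv) (Set.mem_iInter₂.1 hze v hv)
  have habs : ∀ w ∈ S, ∀ H : LipZero M x₀, ‖H‖ ≤ 1 → H E.t = H E.b → E.SupportedOff n H →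
      |w.1 H| ≤ η := by
    intro w hw H h1 h2 h3
    refine abs_le'.2 ⟨hoff w hw H h1 h2 h3, ?_⟩
    rw [← map_neg]
    refine hoff w hw (-H) (by rwa [norm_neg]) ?_ fun x hx => ?_
    · exact congrArg Neg.neg h2
    · exact congrArg Neg.neg (h3 x hx)
  -- As in ℓ₁: `P` lives on `A` and `H` off `A`, so `P + H` is again a local unit, and `w P + w H ≤
  -- ρ` leaves at most `η` for `H`.
  have hrest : ∀ w ∈ S, ρ - η < w.1 P → ∀ H : LipZero M x₀, E.IsLocalUnit n H →
      (∀ a ∈ A, H a = H E.t) → |w.1 H| ≤ η := by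
    intro w hw hwP
    have key : ∀ H : LipZero M x₀, E.IsLocalUnit n H → (∀ a ∈ A, H a = H E.t) → w.1 H ≤ η := by
      intro H hH hHA
      have h := hon w hw (P + H) ⟨fun x hx => ?_, fun x => ?_⟩
      · rw [map_add] at h
        linarith
      · rw [LipZero.add_apply, LipZero.add_apply, hP.1 x hx, hH.1 x hx]
      · rw [LipZero.add_apply, LipZero.add_apply, add_sub_add_comm]
        by_cases hx : x ∈ A
        · rw [hHA x hx, sub_self, add_zero]
          exact hP.2 x
        · have : P x - P E.t = 0 := by rw [hPx]; simp [hx]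
          rw [this, zero_add]
          exact hH.2 x
    intro H hH hHA
    refine abs_le'.2 ⟨key H hH hHA, ?_⟩
    rw [← map_neg]
    exact key (-H) hH.neg fun a ha => congrArg Neg.neg (hHA a ha)
  have hdist : dist y z = ‖y.1 - z.1‖ := dist_eq_norm y.1 z.1
  refine hdist.le.trans ?_
  refine ContinuousLinearMap.opNorm_le_of_unit_norm (by positivity) fun H hH => ?_
  -- The pieces `g`, `G`, `F₁` and `F₂` each vary by at most `2 * η`, and `2 + 2 * 2 + 4 * (2 + 2) =
  -- 22`.
  obtain ⟨c, F, G, hc, hF, hG, hGtb, hGn, rfl⟩ := hg H hH.le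
  obtain ⟨F₁, F₂, hF12, hF₁, hF₂, hF₁x, hF₂x⟩ := hF.exists_split A
  have h1 : |y.1 G - z.1 G| ≤ 2 * η := by
    have := abs_sub (y.1 G) (z.1 G)
    linarith [habs y hyS G hG hGtb hGn, habs z hzS G hG hGtb hGn]
  have hF₂A : ∀ a ∈ A, F₂ a = F₂ E.t := fun a ha => by
    rw [← sub_eq_zero, hF₂x]
    simp [ha]
  have h2 : |y.1 F₂ - z.1 F₂| ≤ 2 * η := by
    have := abs_sub (y.1 F₂) (z.1 F₂)
    linarith [hrest y hyS hyP F₂ hF₂ hF₂A, hrest z hzS hzP F₂ hF₂ hF₂A]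
  have hsum : F₁ = ∑ v ∈ B, (F v - F E.t) • e v := by
    refine LipZero.eq_of_sub_eq E.t fun x => ?_
    rw [LipZero.sum_apply, LipZero.sum_apply, ← Finset.sum_sub_distrib, hF₁x]
    have h : ∀ v ∈ B, ((F v - F E.t) • e v) x - ((F v - F E.t) • e v) E.t =
        if x = v then F v - F E.t else 0 := fun v hv => by
      rw [LipZero.smul_apply, LipZero.smul_apply, ← mul_sub, he v (Finset.mem_filter.1 hv).2]
      simp
    rw [Finset.sum_congr rfl h, Finset.sum_ite_eq]
    by_cases hxA : x ∈ A
    · rw [Set.indicator_of_mem (Finset.mem_coe.2 hxA)]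
      by_cases hxL : x ∈ E.L n
      · rw [if_pos (Finset.mem_filter.2 ⟨hxA, hxL⟩)]
      · rw [if_neg fun h => hxL (Finset.mem_filter.1 h).2, hF.1 x hxL, _root_.sub_self]
    · rw [Set.indicator_of_notMem (fun h => hxA (Finset.mem_coe.1 h)),
        if_neg fun h => hxA (Finset.mem_filter.1 h).1]
  have h3 : |y.1 F₁ - z.1 F₁| ≤ 2 * η := by
    have h : y.1 F₁ - z.1 F₁ = ∑ v ∈ B, (F v - F E.t) * (y.1 (e v) - z.1 (e v)) := by
      rw [hsum, map_sum, map_sum, ← Finset.sum_sub_distrib]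
      refine Finset.sum_congr rfl fun v _ => ?_
      rw [map_smul, map_smul, smul_eq_mul, smul_eq_mul, mul_sub]
    rw [h]
    calc |∑ v ∈ B, (F v - F E.t) * (y.1 (e v) - z.1 (e v))|
        ≤ ∑ v ∈ B, |(F v - F E.t) * (y.1 (e v) - z.1 (e v))| := Finset.abs_sum_le_sum_abs _ _
      _ ≤ ∑ v ∈ B, 2 * η' := by
        refine Finset.sum_le_sum fun v hv => ?_
        rw [abs_mul]
        exact (mul_le_of_le_one_left (abs_nonneg _) (hF.2 v)).trans (heyz v hv)
      _ = B.card * (2 * η') := by rw [Finset.sum_const, nsmul_eq_mul]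
      _ ≤ (B.card + 1) * (2 * η') := mul_le_mul_of_nonneg_right (by linarith) (by linarith)
      _ = 2 * η := by rw [mul_left_comm, hη'mul]
  have h4 : (y.1 - z.1) (c • g + (2 : ℝ) • G + (4 : ℝ) • F) = c * (y.1 g - z.1 g) +
      2 * (y.1 G - z.1 G) + 4 * ((y.1 F₁ - z.1 F₁) + (y.1 F₂ - z.1 F₂)) := by
    rw [hF12]
    simp only [_root_.sub_apply, map_add, map_smul, smul_eq_mul]
  have h5 : |c * (y.1 g - z.1 g)| ≤ 2 * η := by
    rw [abs_mul]
    exact (mul_le_of_le_one_left (abs_nonneg _) hc).trans hgyz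
  rw [h4, Real.norm_eq_abs]
  rw [abs_le] at *
  constructor <;> linarith [h1.1, h1.2, h2.1, h2.2, h3.1, h3.2, h5.1, h5.2]

/-- Almost maximal values of pole-balanced functions are taken on functions supported on some
`L n`. -/
theorem exists_supportedOn_lt {F : LipZero M x₀} (hF : E.IsPoleBalanced F)
    {y : lipschitzFree M x₀} {r : ℝ} (hr : r < y.1 F) :
    ∃ n, ∃ G : LipZero M x₀, E.IsPoleBalanced G ∧ E.SupportedOn n G ∧ r < y.1 G := by
  classical
  obtain ⟨A, hA⟩ := exists_finset_abs_apply_le E.t y (half_pos (sub_pos.2 hr))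
  have hn : ∃ n, ∀ a ∈ A, a ≠ E.t → a ≠ E.b → a ∈ E.L n := by
    clear hA
    induction A using Finset.induction_on with
    | empty => exact ⟨0, by simp⟩
    | insert a A _ ih =>
      obtain ⟨n, hn⟩ := ih
      by_cases ha : a ≠ E.t ∧ a ≠ E.b
      · obtain ⟨m, hm⟩ := E.cover a ha.1 ha.2
        refine ⟨max n m, fun c hc h1 h2 => ?_⟩
        rcases Finset.mem_insert.1 hc with rfl | hc
        · exact E.mono (le_max_right n m) hm
        · exact E.mono (le_max_left n m) (hn c hc h1 h2)
      · refine ⟨n, fun c hc h1 h2 => ?_⟩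
        rcases Finset.mem_insert.1 hc with rfl | hc
        · exact absurd ⟨h1, h2⟩ ha
        · exact hn c hc h1 h2
  obtain ⟨n, hn⟩ := hn
  obtain ⟨G, H, hGH, hG, hH, hGn, hHn⟩ := exists_cut (E := E) hF.2 n
  have hHtb : H E.t = H E.b := by
    have h1 := hGn.top_eq_bot
    have h2 := hF.2
    rw [hGH, LipZero.add_apply, LipZero.add_apply] at h2
    linarith
  refine ⟨n, G, ⟨hG.trans hF.1, hGn.top_eq_bot⟩, hGn, ?_⟩
  have h := hA H fun a ha => by
    by_cases h1 : a = E.t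
    · rw [h1]
    by_cases h2 : a = E.b
    · rw [h2, hHtb]
    exact hHn a (hn a ha h1 h2)
  have h2 : |y.1 H| ≤ (y.1 F - r) / 2 :=
    h.trans (mul_le_of_le_one_right (half_pos (sub_pos.2 hr)).le (hH.trans hF.1))
  have h3 : y.1 F = y.1 G + y.1 H := by rw [← map_add, ← hGH]
  linarith [le_abs_self (y.1 H)]

/-- If the bound fails at `y`, it fails on a slice cut out by some `G` supported on one `L n`.
Inside this slice every single derivation lowers the bound for local units by `η`, which cannot go
on forever. -/
theorem lt_of_mem_weakDerivedIter_add_omega0 {ε η r : ℝ} (hη : 0 < η) (hε : 22 * η < ε)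
    {α : Ordinal} (h : ∀ y ∈ weakDerivedIter ε (Metric.closedBall (0 : lipschitzFree M x₀) 1) α,
      ∀ F : LipZero M x₀, E.IsPoleBalanced F → y.1 F ≤ r) :
    ∀ y ∈ weakDerivedIter ε (Metric.closedBall (0 : lipschitzFree M x₀) 1) (α + ω),
      ∀ F : LipZero M x₀, E.IsPoleBalanced F → y.1 F ≤ r - η := by
  intro y hy F hF
  by_contra! hlt
  obtain ⟨n, G, hG, hGn, hyG⟩ := exists_supportedOn_lt hF hlt
  obtain ⟨C, hC, hnorm, -⟩ := E.exists_norm_le_of_isLocalUnit x₀ n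
  set B := Metric.closedBall (0 : lipschitzFree M x₀) 1 with hB
  have hball : ∀ β, weakDerivedIter ε B β ⊆ B := fun β => by
    have := weakDerivedIter_antitone ε B (zero_le : 0 ≤ β)
    rwa [weakDerivedIter_zero] at this
  have hoff : ∀ w ∈ weakDerivedIter ε B α, r - η < w.1 G → ∀ H : LipZero M x₀, ‖H‖ ≤ 1 →
      H E.t = H E.b → E.SupportedOff n H → w.1 H ≤ η := by
    intro w hw hwG H h1 h2 h3
    have h4 := h w hw (G + H) ⟨norm_add_le_of_supported hG.1 h1 hG.2 h2 hGn h3, by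
      rw [LipZero.add_apply, LipZero.add_apply, hG.2, h2]⟩
    rw [map_add] at h4
    linarith
  -- The bound starts at `C`, which depends on `n`, and must stay nonnegative because 0 is a local
  -- unit.
  have key : ∀ j : ℕ, ∀ w ∈ weakDerivedIter ε B (α + j), r - η < w.1 G →
      ∀ U : LipZero M x₀, E.IsLocalUnit n U → w.1 U ≤ C - j * η := by
    intro j
    induction j with
    | zero =>
      intro w hw _ U hU
      rw [Nat.cast_zero, zero_mul, _root_.sub_zero]
      exact (free_apply_le w (norm_le_one_of_mem_closedBall (hball _ hw)) U).trans (hnorm U hU)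
    | succ j ih =>
      intro w hw hwG U hU
      rw [Nat.cast_add_one, ← add_assoc, weakDerivedIter_add_one] at hw
      by_contra! hlt
      have hlt' : C - j * η - η < w.1 U := by
        push_cast at hlt
        linarith
      have hsub : weakDerivedIter ε B (α + j) ⊆ weakDerivedIter ε B α :=
        weakDerivedIter_antitone ε B le_self_add
      obtain ⟨V, hV, hwV, hVd⟩ := exists_isWeaklyOpen_dist_le
        (S := weakDerivedIter ε B (α + j) ∩ {w | r - η < w.1 G}) hη
        (fun w hw => hoff w (hsub hw.1) hw.2) (fun w hw => ih w hw.1 hw.2) w hU hlt'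
      refine notMem_weakDerivedSet (lt_trans (by positivity) hε) hε
        (V := V ∩ freeEval G ⁻¹' Set.Ioi (r - η))
        (hV.inter (IsWeaklyOpen.preimage_dual _ isOpen_Ioi)) ⟨hwV, hwG⟩ ?_ hw
      rintro a ⟨⟨ha1, ha2⟩, ha3⟩ b ⟨⟨hb1, hb2⟩, hb3⟩
      exact hVd a ⟨ha1, ha3, ha2⟩ b ⟨hb1, hb3, hb2⟩
  obtain ⟨j, hj⟩ := exists_nat_gt (C / η)
  have hyj : y ∈ weakDerivedIter ε B (α + j) :=
    weakDerivedIter_antitone ε B (add_le_add_right (Ordinal.natCast_lt_omega0 j).le α) hy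
  have h0 := key j y hyj hyG 0 ⟨fun _ _ => rfl, fun x => by
    simp only [LipZero.zero_apply, sub_self, abs_zero]; exact zero_le_one⟩
  rw [map_zero] at h0
  rw [div_lt_iff₀ hη] at hj
  linarith

theorem weakFragIndexAt_le {M : Type} [MetricSpace M] {x₀ : M} (E : PoleExhaustion M) {ε : ℝ}
    (hε : 0 < ε) : weakFragIndexAt (lipschitzFree M x₀) ε ≤
      ((ω ^ 2 : Ordinal.{0}) : WithTop Ordinal.{0}) := by
  have hη : 0 < ε / 23 := by positivity
  have key : ∀ m : ℕ, ∀ y ∈ weakDerivedIter ε (Metric.closedBall (0 : lipschitzFree M x₀) 1)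
      (ω * m : Ordinal.{0}), ∀ F : LipZero M x₀, E.IsPoleBalanced F → y.1 F ≤ 1 - m * (ε / 23) := by
    intro m
    induction m with
    | zero =>
      intro y hy F hF
      rw [Nat.cast_zero, mul_zero, weakDerivedIter_zero] at hy
      rw [Nat.cast_zero, zero_mul, _root_.sub_zero]
      exact (free_apply_le y (norm_le_one_of_mem_closedBall hy) F).trans hF.1
    | succ m ih =>
      rw [Nat.cast_add_one, mul_add_one]
      intro y hy F hF
      have := lt_of_mem_weakDerivedIter_add_omega0 hη (by linarith) ih y hy F hF
      push_cast
      linarith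
  obtain ⟨m, hm⟩ := exists_nat_gt (1 / (ε / 23))
  have hempty : weakDerivedIter ε (Metric.closedBall (0 : lipschitzFree M x₀) 1)
      (ω * m : Ordinal.{0}) = ∅ := by
    refine Set.eq_empty_of_forall_notMem fun y hy => ?_
    have h := key m y hy 0 ⟨by rw [norm_zero]; exact zero_le_one, rfl⟩
    rw [map_zero] at h
    rw [div_lt_iff₀ hη] at hm
    linarith
  have hle : weakFragIndexAt (lipschitzFree M x₀) ε ≤
      ((ω * m : Ordinal.{0}) : WithTop Ordinal.{0}) := sInf_le ⟨_, rfl, hempty⟩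
  refine hle.trans (WithTop.coe_le_coe.2 ?_)
  rw [pow_two]
  exact mul_le_mul_right (Ordinal.natCast_lt_omega0 m).le ω

end PoleExhaustion

/-! ### Distances in the diamond graphs -/

theorem EdgePoint.dist_le_pole {P : PoledSpace} (e : ℕ × Bool) (x : P.carrier) :
    dist (⟨e, x⟩ : EdgePoint P) ⟨(0, true), P.top⟩ ≤ dist x P.top / 2 + 1 := by
  refine (EdgePoint.pathDist_le_via _ _ true true).trans ?_
  have h : dist (edgeEnd e true) (edgeEnd (0, true) true) ≤ 1 := by
    rcases e with ⟨j, _ | _⟩ <;> simp [edgeEnd, DiamondVertex.dist_def, DiamondVertex.isPole]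
  simp only [EdgePoint.via, PoledSpace.pole, dist_self]
  linarith

theorem EdgePoint.dist_same {P : PoledSpace} (e : ℕ × Bool) (x y : P.carrier) :
    dist (⟨e, x⟩ : EdgePoint P) ⟨e, y⟩ = dist x y / 2 :=
  if_pos rfl

theorem EdgePoint.mk_eq_mk {P : PoledSpace} {e e' : ℕ × Bool} {u v : Bool}
    (h : edgeEnd e u = edgeEnd e' v) :
    (SeparationQuotient.mk ⟨e, P.pole u⟩ : SeparationQuotient (EdgePoint P)) =
      SeparationQuotient.mk ⟨e', P.pole v⟩ := by
  rw [← dist_le_zero, SeparationQuotient.dist_mk]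
  refine (EdgePoint.pathDist_le_via _ _ u v).trans ?_
  simp [EdgePoint.via, h]

theorem DiamondVertex.one_le_dist {x y : DiamondVertex} (h : x ≠ y) : 1 ≤ dist x y := by
  rw [DiamondVertex.dist_def, if_neg h]
  split_ifs <;> norm_num

theorem DiamondVertex.dist_le_two (x y : DiamondVertex) : dist x y ≤ 2 := by
  rw [DiamondVertex.dist_def]
  split_ifs <;> norm_num

theorem finiteDiamond_dist_top_le (n : ℕ) (x : (finiteDiamond n).carrier) :
    dist x (finiteDiamond n).top ≤ 2 := by
  induction n with
  | zero => exact DiamondVertex.dist_le_two x _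
  | succ n ih =>
    obtain ⟨p, rfl⟩ := SeparationQuotient.surjective_mk x
    refine (SeparationQuotient.dist_mk _ _).le.trans ((EdgePoint.dist_le_pole p.edge p.pt).trans ?_)
    linarith [ih p.pt]

/-- Points at positive distance in different copies are joined by a path with a nontrivial leg:
inside a copy it has at least half the previous minimum, between vertices of `D₁` at least 1. -/
theorem finiteDiamond_le_dist (n : ℕ) (x y : (finiteDiamond n).carrier) (hxy : x ≠ y) :
    (1 / 2 : ℝ) ^ n ≤ dist x y := by
  induction n with
  | zero =>
    rw [pow_zero]
    exact DiamondVertex.one_le_dist hxy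
  | succ n ih =>
    obtain ⟨p, rfl⟩ := SeparationQuotient.surjective_mk x
    obtain ⟨q, rfl⟩ := SeparationQuotient.surjective_mk y
    have hd : dist p q ≠ 0 := fun h =>
      hxy (SeparationQuotient.mk_eq_mk.2 (Metric.inseparable_iff.2 h))
    refine le_of_le_of_eq ?_ (SeparationQuotient.dist_mk p q).symm
    have hpow : (1 / 2 : ℝ) ^ (n + 1) = (1 / 2 : ℝ) ^ n / 2 := by rw [pow_succ]; ring
    rw [hpow]
    rw [EdgePoint.dist_def] at hd ⊢
    by_cases he : p.edge = q.edge
    · have h1 : EdgePoint.pathDist p q = dist p.pt q.pt / 2 := if_pos he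
      rw [h1] at hd ⊢
      have h2 : p.pt ≠ q.pt := fun h => hd (by rw [h, dist_self, zero_div])
      linarith [ih _ _ h2]
    · obtain ⟨u, v, h1⟩ := EdgePoint.exists_pathDist_eq_via he
      rw [h1] at hd ⊢
      unfold EdgePoint.via at hd ⊢
      have h2 : (0 : ℝ) ≤ dist p.pt ((finiteDiamond n).pole u) := dist_nonneg
      have h3 : (0 : ℝ) ≤ dist ((finiteDiamond n).pole v) q.pt := dist_nonneg
      have h4 : (0 : ℝ) ≤ dist (edgeEnd p.edge u) (edgeEnd q.edge v) := dist_nonneg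
      by_cases hp : p.pt = (finiteDiamond n).pole u
      · by_cases hq : (finiteDiamond n).pole v = q.pt
        · by_cases hpq : edgeEnd p.edge u = edgeEnd q.edge v
          · rw [← hp, hq, hpq] at hd
            simp at hd
          · have h5 := DiamondVertex.one_le_dist hpq
            have h6 : (1 / 2 : ℝ) ^ n ≤ 1 := pow_le_one₀ (by norm_num) (by norm_num)
            linarith
        · linarith [ih _ _ hq]
      · linarith [ih _ _ hp]

/-- The inclusion of `D_{n+1}` in `D_ω`. -/
def toDiamondOmega (n : ℕ) (x : (finiteDiamond n).carrier) : DiamondOmega :=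
  SeparationQuotient.mk ⟨n, x⟩

theorem dist_toDiamondOmega (n : ℕ) (x y : (finiteDiamond n).carrier) :
    dist (toDiamondOmega n x) (toDiamondOmega n y) = dist x y :=
  (SeparationQuotient.dist_mk _ _).trans (OmegaPoint.glueDist_mk_same n x y)

theorem exists_toDiamondOmega_eq (x : DiamondOmega) : ∃ n y, toDiamondOmega n y = x := by
  obtain ⟨p, rfl⟩ := SeparationQuotient.surjective_mk x
  exact ⟨p.level, p.pt, rfl⟩

theorem toDiamondOmega_pole (n m : ℕ) (u : Bool) :
    toDiamondOmega n ((finiteDiamond n).pole u) = toDiamondOmega m ((finiteDiamond m).pole u) := by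
  rw [← dist_le_zero]
  refine (SeparationQuotient.dist_mk _ _).le.trans ((OmegaPoint.glueDist_le u).trans ?_)
  simp [OmegaPoint.poleDist]

theorem dist_toDiamondOmega_of_ne {n m : ℕ} (h : n ≠ m) (x : (finiteDiamond n).carrier)
    (y : (finiteDiamond m).carrier) : ∃ u, dist (toDiamondOmega n x) (toDiamondOmega m y) =
      dist x ((finiteDiamond n).pole u) + dist ((finiteDiamond m).pole u) y := by
  obtain ⟨u, hu⟩ := OmegaPoint.exists_glueDist_eq (p := ⟨n, x⟩) (q := ⟨m, y⟩) h
  refine ⟨u, (SeparationQuotient.dist_mk _ _).trans (hu.trans ?_)⟩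
  rw [dist_comm _ y]
  rfl

/-- The exhaustion of `D_ω` by the diamonds of bounded depth. -/
def diamondExhaustion : PoleExhaustion DiamondOmega where
  t := toDiamondOmega 0 (finiteDiamond 0).top
  b := toDiamondOmega 0 (finiteDiamond 0).bot
  L n := {x | ∃ k < n, ∃ y, toDiamondOmega k y = x ∧
    y ≠ (finiteDiamond k).pole true ∧ y ≠ (finiteDiamond k).pole false}
  dist_poles := by rw [dist_toDiamondOmega, (finiteDiamond 0).dist_top_bot]
  mono n m hnm := by
    rintro x ⟨k, hk, y, h⟩
    exact ⟨k, hk.trans_le hnm, y, h⟩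
  cover x ht hb := by
    obtain ⟨n, y, rfl⟩ := exists_toDiamondOmega_eq x
    refine ⟨n + 1, n, n.lt_succ_self, y, rfl, fun h => ht ?_, fun h => hb ?_⟩
    · rw [h]; exact toDiamondOmega_pole n 0 true
    · rw [h]; exact toDiamondOmega_pole n 0 false
  top_notMem n := by
    rintro ⟨k, -, y, h, ht, -⟩
    refine ht (dist_eq_zero.1 ?_)
    rw [← dist_toDiamondOmega, h, dist_eq_zero]
    exact toDiamondOmega_pole 0 k true
  bot_notMem n := by
    rintro ⟨k, -, y, h, -, hb⟩
    refine hb (dist_eq_zero.1 ?_)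
    rw [← dist_toDiamondOmega, h, dist_eq_zero]
    exact toDiamondOmega_pole 0 k false
  separated n := by
    refine ⟨(1 / 2 : ℝ) ^ n, by positivity, ?_⟩
    rintro x ⟨k, hk, y, rfl, ht, hb⟩ z hz
    refine (pow_le_pow_of_le_one (by norm_num) (by norm_num) hk.le).trans ?_
    obtain ⟨m, z, rfl⟩ := exists_toDiamondOmega_eq z
    rcases eq_or_ne k m with rfl | hkm
    · rw [dist_toDiamondOmega]
      exact finiteDiamond_le_dist k _ _ fun h => hz (by rw [h])
    · obtain ⟨u, hu⟩ := dist_toDiamondOmega_of_ne hkm y z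
      rw [hu]
      refine le_add_of_le_of_nonneg (finiteDiamond_le_dist k _ _ ?_) dist_nonneg
      cases u
      exacts [hb, ht]
  dist_top_le n := by
    rintro x ⟨k, hk, y, rfl, -⟩
    have h : toDiamondOmega 0 (finiteDiamond 0).top = toDiamondOmega k (finiteDiamond k).top :=
      toDiamondOmega_pole 0 k true
    rw [h, dist_toDiamondOmega]
    exact finiteDiamond_dist_top_le k y
  cross n := by
    rintro x ⟨k, hk, y, rfl, ht, hb⟩ z hz
    have ht' : toDiamondOmega 0 (finiteDiamond 0).top =
        toDiamondOmega k ((finiteDiamond k).pole true) := toDiamondOmega_pole 0 k true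
    have hb' : toDiamondOmega 0 (finiteDiamond 0).bot =
        toDiamondOmega k ((finiteDiamond k).pole false) := toDiamondOmega_pole 0 k false
    obtain ⟨m, z, rfl⟩ := exists_toDiamondOmega_eq z
    -- A point outside `L n` is either a pole or lies in a diamond of another level, which can be
    -- reached only through a pole.
    by_cases hm : m < n
    · by_cases h1 : z = (finiteDiamond m).pole true
      · left
        rw [h1, ht', toDiamondOmega_pole m k true, dist_self, add_zero]
      by_cases h2 : z = (finiteDiamond m).pole false
      · right
        rw [h2, hb', toDiamondOmega_pole m k false, dist_self, add_zero]
      · exact absurd ⟨m, hm, z, rfl, h1, h2⟩ hz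
    · have hkm : k ≠ m := fun h => hm (h ▸ hk)
      obtain ⟨u, hu⟩ := dist_toDiamondOmega_of_ne hkm y z
      rw [hu, ht', hb']
      cases u
      · right
        rw [dist_toDiamondOmega, toDiamondOmega_pole k m false, dist_toDiamondOmega]
      · left
        rw [dist_toDiamondOmega, toDiamondOmega_pole k m true, dist_toDiamondOmega]

/-! ### Lipschitz functions on the diamond graphs -/

/-- Functions on the edges of `D₁` that agree at the vertices with a `1`-Lipschitz function define
a `1`-Lipschitz function. -/
theorem PoledSpace.exists_lipschitz_replaceEdges (P : PoledSpace) (φ : DiamondVertex → ℝ)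
    (hφ : ∀ x y, |φ x - φ y| ≤ dist x y) (h : ℕ × Bool → P.carrier → ℝ)
    (hlip : ∀ e x y, |h e x - h e y| ≤ dist x y / 2)
    (hpole : ∀ e u, h e (P.pole u) = φ (edgeEnd e u)) :
    ∃ f : P.replaceEdges.carrier → ℝ, (∀ x y, |f x - f y| ≤ dist x y) ∧
      ∀ e x, f (SeparationQuotient.mk ⟨e, x⟩) = h e x := by
  have key : ∀ p q : EdgePoint P, |h p.edge p.pt - h q.edge q.pt| ≤ dist p q := by
    intro p q
    rw [EdgePoint.dist_def]
    by_cases he : p.edge = q.edge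
    · have h1 : EdgePoint.pathDist p q = dist p.pt q.pt / 2 := if_pos he
      rw [h1, he]
      exact hlip _ _ _
    · obtain ⟨u, v, h1⟩ := EdgePoint.exists_pathDist_eq_via he
      rw [h1, EdgePoint.via]
      have h2 := hlip p.edge p.pt (P.pole u)
      have h3 := hφ (edgeEnd p.edge u) (edgeEnd q.edge v)
      have h4 := hlip q.edge (P.pole v) q.pt
      rw [hpole] at h2 h4
      rw [abs_le] at *
      constructor <;> linarith [h2.1, h2.2, h3.1, h3.2, h4.1, h4.2]
  refine ⟨SeparationQuotient.lift (fun p : EdgePoint P => h p.edge p.pt) fun p q hpq => ?_,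
    fun x y => ?_, fun e x => rfl⟩
  · have h1 := key p q
    rw [Metric.inseparable_iff.1 hpq] at h1
    exact sub_eq_zero.1 (abs_nonpos_iff.1 h1)
  · obtain ⟨p, rfl⟩ := SeparationQuotient.surjective_mk x
    obtain ⟨q, rfl⟩ := SeparationQuotient.surjective_mk y
    exact (key p q).trans_eq (SeparationQuotient.dist_mk p q).symm

/-- The vertices of the copy of `D₁` in `D_{n+1}` that replaces the edge with address `w`. -/
def diamondVertex : (n : ℕ) → List (ℕ × Bool) → DiamondVertex → (finiteDiamond n).carrier
  | 0, _, v => v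
  | n + 1, [], .top => (finiteDiamond (n + 1)).top
  | n + 1, [], .bot => (finiteDiamond (n + 1)).bot
  -- The `k`-th midpoint is taken as the lower end of its upper edge; by the gluing it is also the
  -- upper end of its lower edge.
  | n + 1, [], .mid k => SeparationQuotient.mk ⟨(k, true), (finiteDiamond n).bot⟩
  | n + 1, e :: w, v => SeparationQuotient.mk ⟨e, diamondVertex n w v⟩

theorem diamondVertex_nil_top (n : ℕ) :
    diamondVertex n [] .top = (finiteDiamond n).top := by
  cases n <;> rfl

theorem diamondVertex_nil_bot (n : ℕ) :
    diamondVertex n [] .bot = (finiteDiamond n).bot := by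
  cases n <;> rfl

theorem diamondVertex_singleton (n : ℕ) (e : ℕ × Bool) :
    diamondVertex (n + 1) [e] .top = diamondVertex (n + 1) [] (edgeEnd e true) ∧
      diamondVertex (n + 1) [e] .bot = diamondVertex (n + 1) [] (edgeEnd e false) := by
  constructor
  · refine (congrArg (fun x => SeparationQuotient.mk (⟨e, x⟩ : EdgePoint (finiteDiamond n)))
      (diamondVertex_nil_top n)).trans ?_
    rcases e with ⟨j, _ | _⟩
    · exact EdgePoint.mk_eq_mk (P := finiteDiamond n) (e := (j, false)) (e' := (j, true))
        (u := true) (v := false) rfl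
    · exact EdgePoint.mk_eq_mk (P := finiteDiamond n) (e := (j, true)) (e' := (0, true))
        (u := true) (v := true) rfl
  · refine (congrArg (fun x => SeparationQuotient.mk (⟨e, x⟩ : EdgePoint (finiteDiamond n)))
      (diamondVertex_nil_bot n)).trans ?_
    rcases e with ⟨j, _ | _⟩
    · exact EdgePoint.mk_eq_mk (P := finiteDiamond n) (e := (j, false)) (e' := (0, false))
        (u := false) (v := false) rfl
    · rfl

/-- Extending an address by `e` passes to the copy replacing the edge `e`, whose poles are the ends
of that edge. -/
theorem diamondVertex_append (n : ℕ) (w : List (ℕ × Bool)) (hw : w.length < n) (e : ℕ × Bool) :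
    diamondVertex n (w ++ [e]) .top = diamondVertex n w (edgeEnd e true) ∧
      diamondVertex n (w ++ [e]) .bot = diamondVertex n w (edgeEnd e false) := by
  induction w generalizing n with
  | nil =>
    obtain ⟨n, rfl⟩ := Nat.exists_eq_add_one.2 hw
    exact diamondVertex_singleton n e
  | cons e' w ih =>
    obtain ⟨n, rfl⟩ := Nat.exists_eq_add_one.2 (Nat.zero_lt_of_lt hw)
    obtain ⟨h1, h2⟩ := ih n (Nat.lt_of_succ_lt_succ hw)
    exact ⟨congrArg (fun x => SeparationQuotient.mk (⟨e', x⟩ : EdgePoint (finiteDiamond n))) h1,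
      congrArg (fun x => SeparationQuotient.mk (⟨e', x⟩ : EdgePoint (finiteDiamond n))) h2⟩

theorem dist_diamondVertex (n : ℕ) (w : List (ℕ × Bool)) (hw : w.length ≤ n) :
    dist (diamondVertex n w .top) (diamondVertex n w .bot) = 2 * (1 / 2 : ℝ) ^ w.length := by
  induction w generalizing n with
  | nil =>
    rw [diamondVertex_nil_top, diamondVertex_nil_bot, (finiteDiamond n).dist_top_bot]
    simp
  | cons e w ih =>
    obtain ⟨n, rfl⟩ := Nat.exists_eq_add_one.2 (Nat.zero_lt_of_lt hw)
    refine (SeparationQuotient.dist_mk _ _).trans ((EdgePoint.dist_same e _ _).trans ?_)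
    rw [ih n (Nat.le_of_succ_le_succ hw), List.length_cons, pow_succ]
    ring

/-- One function prescribes the same pattern `s` at the midpoints of all copies of generation `i`,
so it separates midpoints in every copy simultaneously, at full slope. -/
theorem exists_lipschitz_finiteDiamond (n i : ℕ) (hi : i ≤ n) (s : ℕ → ℝ) (hs : ∀ k, |s k| ≤ 1) :
    ∃ f : (finiteDiamond n).carrier → ℝ, (∀ x y, |f x - f y| ≤ dist x y) ∧
      (∀ u, f ((finiteDiamond n).pole u) = 0) ∧
      ∀ w : List (ℕ × Bool), w.length = i → ∀ k,
        f (diamondVertex n w (.mid k)) = s k * (1 / 2 : ℝ) ^ i := by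
  set φ : DiamondVertex → ℝ := fun v => match v with
    | .mid k => s k
    | _ => 0 with hφ
  have hφlip : ∀ x y, |φ x - φ y| ≤ dist x y := by
    intro x y
    have hs' := hs
    have h2 : ∀ k l, |s k - s l| ≤ 2 := fun k l => by
      linarith [abs_sub (s k) (s l), hs k, hs l]
    rcases eq_or_ne x y with rfl | hxy
    · simp
    rw [DiamondVertex.dist_def, if_neg hxy]
    cases x <;> cases y <;> simp_all [DiamondVertex.isPole]
  induction n generalizing i with
  | zero =>
    obtain rfl : i = 0 := Nat.le_zero.1 hi
    refine ⟨φ, hφlip, fun u => by cases u <;> rfl, fun w _ k => ?_⟩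
    rw [pow_zero, mul_one]
    rfl
  | succ n ih =>
    cases i with
    | zero =>
      set P := finiteDiamond n
      obtain ⟨f, hf, hfe⟩ := P.exists_lipschitz_replaceEdges φ hφlip
        -- Interpolation along each edge: the last factor is 1 at the top pole, 0 at the bottom pole
        -- and half-Lipschitz, while the values of `φ` at the two ends differ by at most 1.
        (fun e x => φ (edgeEnd e false) + (φ (edgeEnd e true) - φ (edgeEnd e false)) *
          ((dist x P.bot - dist x P.top + 2) / 4)) (fun e x y => by
          have h1 := abs_dist_sub_le x y P.bot
          have h2 := abs_dist_sub_le x y P.top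
          have h3 := hφlip (edgeEnd e true) (edgeEnd e false)
          rw [dist_edgeEnd P, show dist (P.pole true) (P.pole false) = 2 from P.dist_top_bot] at h3
          have h4 : |(dist x P.bot - dist x P.top + 2) / 4 - (dist y P.bot - dist y P.top + 2) / 4| ≤
              dist x y / 2 := by
            rw [abs_le] at *
            constructor <;> linarith [h1.1, h1.2, h2.1, h2.2]
          rw [add_sub_add_left_eq_sub, ← mul_sub, abs_mul]
          refine (mul_le_of_le_one_left (abs_nonneg _) ?_).trans h4
          linarith)
        (fun e u => by
          have h1 := P.dist_top_bot
          have h2 := P.dist_top_bot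
          rw [dist_comm] at h2
          cases u
          · simp [PoledSpace.pole, h2]
          · simp only [PoledSpace.pole, dist_self, h1]
            ring)
      refine ⟨f, hf, fun u => ?_, fun w hw k => ?_⟩
      · have h1 := P.dist_top_bot
        have h2 := P.dist_top_bot
        rw [dist_comm] at h2
        cases u
        · refine (hfe (0, false) P.bot).trans ?_
          simp [h2, hφ, edgeEnd]
        · refine (hfe (0, true) P.top).trans ?_
          simp only [dist_self, h1, hφ, edgeEnd]
          ring
      · obtain rfl := List.length_eq_zero_iff.1 hw
        refine (hfe (k, true) P.bot).trans ?_
        have h2 := P.dist_top_bot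
        rw [dist_comm] at h2
        simp [h2, hφ, edgeEnd]
    | succ i =>
      obtain ⟨g, hg, hgp, hgw⟩ := ih i (Nat.le_of_succ_le_succ hi)
      -- The function of the previous depth, halved, is placed on every edge; vanishing at the poles
      -- makes the copies match.
      obtain ⟨f, hf, hfe⟩ := (finiteDiamond n).exists_lipschitz_replaceEdges (fun _ => 0)
        (fun x y => by simp) (fun e x => g x / 2) (fun e x y => by
          rw [← sub_div, abs_div, abs_two]
          linarith [hg x y]) (fun e u => by rw [hgp, zero_div])
      refine ⟨f, hf, fun u => ?_, fun w hw k => ?_⟩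
      · cases u
        · refine (hfe (0, false) (finiteDiamond n).bot).trans ?_
          have h := hgp false
          rw [show g (finiteDiamond n).bot = 0 from h, zero_div]
        · refine (hfe (0, true) (finiteDiamond n).top).trans ?_
          have h := hgp true
          rw [show g (finiteDiamond n).top = 0 from h, zero_div]
      · obtain ⟨e, w, rfl⟩ := List.exists_cons_of_length_eq_add_one hw
        refine (hfe e _).trans ?_
        rw [hgw w (Nat.succ_injective hw) k, pow_succ]
        ring

/-- A `1`-Lipschitz function on `D_{n+1}` vanishing at the poles extends to `D_ω`. -/
theorem exists_lipZero_diamondOmega (n : ℕ) (f : (finiteDiamond n).carrier → ℝ)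
    (hf : ∀ x y, |f x - f y| ≤ dist x y) (hpole : ∀ u, f ((finiteDiamond n).pole u) = 0) :
    ∃ F : LipZero DiamondOmega DiamondOmega.base, ‖F‖ ≤ 1 ∧
      ∀ x y, F (toDiamondOmega n x) - F (toDiamondOmega n y) = f x - f y := by
  classical
  set g : (m : ℕ) → (finiteDiamond m).carrier → ℝ := fun m x =>
    if h : m = n then f (h ▸ x) else 0 with hg
  have hgn : ∀ x, g n x = f x := fun x => by simp [hg]
  have hgm : ∀ m, m ≠ n → ∀ x, g m x = 0 := fun m hm x => dif_neg hm
  have hgu : ∀ m x u, |g m x| ≤ dist x ((finiteDiamond m).pole u) := by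
    intro m x u
    rcases eq_or_ne m n with rfl | hm
    · have h := hf x ((finiteDiamond m).pole u)
      rwa [hpole, sub_zero, ← hgn] at h
    · rw [hgm m hm, abs_zero]
      exact dist_nonneg
  have key : ∀ p q : OmegaPoint, |g p.level p.pt - g q.level q.pt| ≤ dist p q := by
    rintro ⟨m, x⟩ ⟨k, y⟩
    rcases eq_or_ne m k with rfl | hmk
    · refine le_of_le_of_eq ?_ (OmegaPoint.glueDist_mk_same m x y).symm
      rcases eq_or_ne m n with rfl | hm
      · simp only [hgn]
        exact hf x y
      · simp only [hgm m hm, sub_zero, abs_zero]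
        exact dist_nonneg
    · obtain ⟨u, hu⟩ := OmegaPoint.exists_glueDist_eq (p := ⟨m, x⟩) (q := ⟨k, y⟩) hmk
      refine le_of_le_of_eq ?_ hu.symm
      exact (abs_sub _ _).trans (add_le_add (hgu m x u) (hgu k y u))
  have hsep : ∀ p q : OmegaPoint, Inseparable p q → g p.level p.pt = g q.level q.pt := by
    intro p q hpq
    have h1 := key p q
    rw [Metric.inseparable_iff.1 hpq] at h1
    exact sub_eq_zero.1 (abs_nonpos_iff.1 h1)
  have hlip : ∀ x y : DiamondOmega, |SeparationQuotient.lift _ hsep x -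
      SeparationQuotient.lift _ hsep y| ≤ 1 * dist x y := by
    intro x y
    rw [one_mul]
    obtain ⟨p, rfl⟩ := SeparationQuotient.surjective_mk x
    obtain ⟨q, rfl⟩ := SeparationQuotient.surjective_mk y
    exact (key p q).trans_eq (SeparationQuotient.dist_mk p q).symm
  refine ⟨LipZero.ofFun _ _ 1 hlip, LipZero.norm_ofFun_le zero_le_one hlip, fun x y => ?_⟩
  rw [LipZero.ofFun_sub, ← hgn, ← hgn]
  rfl

/-! ### Molecules in the Lipschitz-free space over `D_ω` -/

/-- The evaluation functional `δ(x)` as an element of the Lipschitz-free space. -/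
def freeDelta {M : Type*} [MetricSpace M] (x₀ x : M) : lipschitzFree M x₀ :=
  ⟨lipDelta x₀ x, Submodule.le_topologicalClosure _ (Submodule.subset_span ⟨x, rfl⟩)⟩

theorem freeDelta_apply {M : Type*} [MetricSpace M] {x₀ : M} (x : M) (F : LipZero M x₀) :
    freeEval F (freeDelta x₀ x) = F x := rfl

theorem norm_freeDelta_sub_le {M : Type*} [MetricSpace M] {x₀ : M} (x y : M) :
    ‖freeDelta x₀ x - freeDelta x₀ y‖ ≤ dist x y := by
  change ‖lipDelta x₀ x - lipDelta x₀ y‖ ≤ dist x y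
  refine ContinuousLinearMap.opNorm_le_bound _ dist_nonneg fun F => ?_
  rw [_root_.sub_apply, lipDelta_apply, lipDelta_apply, Real.norm_eq_abs, mul_comm]
  exact F.abs_sub_le x y

theorem freeEval_le_norm {M : Type*} [MetricSpace M] {x₀ : M} {F : LipZero M x₀} (hF : ‖F‖ ≤ 1)
    (y : lipschitzFree M x₀) : freeEval F y ≤ ‖y‖ :=
  (le_abs_self _).trans ((y.1.le_opNorm F).trans (mul_le_of_le_one_right (norm_nonneg _) hF))

section Molecules

variable {X : Type*} [NormedAddCommGroup X] [NormedSpace ℝ X] (D : DiamondOmega → X)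

/-- A map behaving like the evaluation map `δ` into the Lipschitz-free space over `D_ω`. -/
structure IsFreeEmbedding : Prop where
  norm_sub_le : ∀ x y, ‖D x - D y‖ ≤ dist x y
  exists_dual : ∀ F : LipZero DiamondOmega DiamondOmega.base, ‖F‖ ≤ 1 →
    ∃ φ : StrongDual ℝ X, (∀ y, φ y ≤ ‖y‖) ∧ ∀ x, φ (D x) = F x

/-- The image under `D` of the vertex `v` of the copy of `D₁` with address `w` in `D_{n+1}`. -/
def vertexImage (n : ℕ) (w : List (ℕ × Bool)) (v : DiamondVertex) : X :=
  D (toDiamondOmega n (diamondVertex n w v))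

/-- The molecule of the poles of the copy with address `w` in `D_{n+1}`. -/
def diamondMolecule (n : ℕ) (w : List (ℕ × Bool)) : X :=
  ((2 : ℝ) ^ w.length / 2) • (vertexImage D n w .top - vertexImage D n w .bot)

variable {D}

theorem norm_diamondMolecule_le (hD : IsFreeEmbedding D) (n : ℕ) (w : List (ℕ × Bool)) (hw : w.length ≤ n) :
    ‖diamondMolecule D n w‖ ≤ 1 := by
  have h : ‖vertexImage D n w .top - vertexImage D n w .bot‖ ≤ 2 * (1 / 2 : ℝ) ^ w.length := by
    refine (hD.norm_sub_le _ _).trans ?_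
    rw [dist_toDiamondOmega, dist_diamondVertex n w hw]
  rw [diamondMolecule, norm_smul, Real.norm_of_nonneg (by positivity)]
  calc (2 : ℝ) ^ w.length / 2 * ‖vertexImage D n w .top - vertexImage D n w .bot‖
      ≤ (2 : ℝ) ^ w.length / 2 * (2 * (1 / 2 : ℝ) ^ w.length) := by gcongr
    _ = 1 := by
      rw [one_div, inv_pow]
      field_simp

/-- Combining the upper half through midpoint `k` with the lower half through midpoint `l` leaves
the mismatch at the midpoints; for `k = l` the average is exact. -/
theorem midpoint_diamondMolecule (n : ℕ) (w : List (ℕ × Bool)) (hw : w.length < n) (k l : ℕ) :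
    (1 / 2 : ℝ) • diamondMolecule D n (w ++ [(k, true)]) +
      (1 / 2 : ℝ) • diamondMolecule D n (w ++ [(l, false)]) = diamondMolecule D n w +
        ((2 : ℝ) ^ w.length / 2) • (vertexImage D n w (.mid l) - vertexImage D n w (.mid k)) := by
  obtain ⟨h1, h2⟩ := diamondVertex_append n w hw (k, true)
  obtain ⟨h3, h4⟩ := diamondVertex_append n w hw (l, false)
  have e1 : vertexImage D n (w ++ [(k, true)]) .top = vertexImage D n w .top := by
    rw [vertexImage, h1]; rfl
  have e2 : vertexImage D n (w ++ [(k, true)]) .bot = vertexImage D n w (.mid k) := by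
    rw [vertexImage, h2]; rfl
  have e3 : vertexImage D n (w ++ [(l, false)]) .top = vertexImage D n w (.mid l) := by
    rw [vertexImage, h3]; rfl
  have e4 : vertexImage D n (w ++ [(l, false)]) .bot = vertexImage D n w .bot := by
    rw [vertexImage, h4]; rfl
  simp only [diamondMolecule, e1, e2, e3, e4, List.length_append, List.length_singleton, pow_succ]
  module

variable (D) in
/-- The convex hull of the molecules of the edges of the `i`-th generation in `D_{n+1}`. -/
def moleculeHull (n i : ℕ) : Set X :=
  convexHull ℝ (diamondMolecule D n '' {w | w.length = i})

theorem moleculeHull_subset_closedBall (hD : IsFreeEmbedding D) {n i : ℕ} (hi : i ≤ n) :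
    moleculeHull D n i ⊆ Metric.closedBall (0 : X) 1 := by
  refine convexHull_min ?_ (convex_closedBall _ _)
  rintro _ ⟨w, hw, rfl⟩
  rw [mem_closedBall_zero_iff]
  exact norm_diamondMolecule_le hD n w (by rw [hw.out]; exact hi)

theorem half_add_half_mem_moleculeHull {n i : ℕ} {w : List (ℕ × Bool)} (hw : w.length = i)
    (e e' : ℕ × Bool) : (1 / 2 : ℝ) • diamondMolecule D n (w ++ [e]) +
      (1 / 2 : ℝ) • diamondMolecule D n (w ++ [e']) ∈ moleculeHull D n (i + 1) := by
  have h : ∀ e, diamondMolecule D n (w ++ [e]) ∈ moleculeHull D n (i + 1) := fun e =>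
    subset_convexHull ℝ _ (Set.mem_image_of_mem _ (by simp [hw]))
  exact convex_convexHull ℝ _ (h e) (h e') (by norm_num) (by norm_num) (by norm_num)

theorem norm_vertexImage_mid_sub_le (hD : IsFreeEmbedding D) (n : ℕ) (w : List (ℕ × Bool)) (k : ℕ) :
    ‖vertexImage D n w (.mid k) - vertexImage D n [] .top‖ ≤ 2 := by
  refine (hD.norm_sub_le _ _).trans ?_
  rw [dist_toDiamondOmega, diamondVertex_nil_top]
  exact finiteDiamond_dist_top_le n _

/-- Each element of a hull of molecules is weakly approximated by elements of the hull of the next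
generation at distance at least `1`. -/
theorem exists_mem_moleculeHull_one_le_dist (hD : IsFreeEmbedding D) {n i : ℕ} (hi : i < n) {z : X}
    (hz : z ∈ moleculeHull D n i) {V : Set X} (hV : IsWeaklyOpen V) (hzV : z ∈ V) :
    ∃ y ∈ V ∩ moleculeHull D n (i + 1), 1 ≤ dist z y := by
  obtain ⟨ι, _, a, m, ha, hsum, hm, rfl⟩ := mem_convexHull_iff_exists_fintype.1 hz
  choose w hw hwm using hm
  replace hw : ∀ j, (w j).length = i := hw
  set c : ℝ := (2 : ℝ) ^ i / 2 with hc
  have hc0 : 0 ≤ c := by positivity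
  -- The same midpoint index is used in all copies at once. Subtracting the pole only keeps `R`
  -- bounded; it cancels in `R l - R k`.
  set R : ℕ → X := fun k =>
    ∑ j, a j • c • (vertexImage D n (w j) (.mid k) - vertexImage D n [] .top) with hR
  have hRb : ∀ k, ‖R k‖ ≤ ∑ j, a j * (c * 2) := by
    intro k
    refine norm_sum_le_of_le _ fun j _ => ?_
    rw [norm_smul, norm_smul, Real.norm_of_nonneg (ha j), Real.norm_of_nonneg hc0]
    have := norm_vertexImage_mid_sub_le hD n (w j) k
    have := ha j
    gcongr
  obtain ⟨k, l, hkl, hmem⟩ := hV.exists_add_sub_mem hzV hRb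
  have hdiff : R l - R k =
      ∑ j, a j • c • (vertexImage D n (w j) (.mid l) - vertexImage D n (w j) (.mid k)) := by
    rw [hR, ← Finset.sum_sub_distrib]
    refine Finset.sum_congr rfl fun j _ => ?_
    module
  refine ⟨_, ⟨hmem, ?_⟩, ?_⟩
  · have h : ∑ j, a j • m j + R l - R k = ∑ j, a j •
        ((1 / 2 : ℝ) • diamondMolecule D n (w j ++ [(k, true)]) +
          (1 / 2 : ℝ) • diamondMolecule D n (w j ++ [(l, false)])) := by
      rw [add_sub_assoc, hdiff, ← Finset.sum_add_distrib]
      refine Finset.sum_congr rfl fun j _ => ?_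
      rw [midpoint_diamondMolecule n (w j) (by rw [hw j]; exact hi), hw j, ← hwm j, ← smul_add]
    rw [h]
    exact (convex_convexHull ℝ _).sum_mem (fun j _ => ha j) hsum fun j _ =>
      half_add_half_mem_moleculeHull (hw j) _ _
  -- With value 1 at `l` and -1 elsewhere, each copy contributes `(2 ^ i / 2) * 2 * (1 / 2) ^ i =
  -- 1`, so the convex combination gives exactly 1 without cancellation.
  · obtain ⟨f, hf, hfp, hfw⟩ := exists_lipschitz_finiteDiamond n i hi.le
      (fun q => if q = l then 1 else -1) (fun q => by split_ifs <;> simp)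
    obtain ⟨F, hF, hFf⟩ := exists_lipZero_diamondOmega n f hf hfp
    obtain ⟨φ, hφ, hφD⟩ := hD.exists_dual F hF
    have hval : φ (R l - R k) = 1 := by
      rw [hdiff, map_sum]
      refine Eq.trans (Finset.sum_congr rfl fun j _ => ?_) hsum
      rw [map_smul, map_smul, map_sub, vertexImage, vertexImage, hφD, hφD,
        hFf, hfw _ (hw j), hfw _ (hw j), if_pos rfl, if_neg hkl, hc, smul_eq_mul, smul_eq_mul]
      have h : (2 : ℝ) ^ i * (1 / 2 : ℝ) ^ i = 1 := by rw [← mul_pow]; norm_num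
      linear_combination a j * h
    have hd : dist (∑ j, a j • m j) (∑ j, a j • m j + R l - R k) = ‖R l - R k‖ := by
      rw [dist_comm, dist_eq_norm, add_sub_assoc, add_sub_cancel_left]
    rw [hd, ← hval]
    exact hφ _

/-- Each hull lies in the derived set of the next one, so moving down from generation `n` to
generation `i` gains `n - i` derivations. -/
theorem moleculeHull_subset_weakDerivedIter (hD : IsFreeEmbedding D) (n j : ℕ) :
    ∀ i, i + j = n → moleculeHull D n i ⊆
      weakDerivedIter 1 (Metric.closedBall (0 : X) 1) (j : Ordinal.{0}) := by
  induction j with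
  | zero =>
    intro i hi
    rw [Nat.cast_zero, weakDerivedIter_zero]
    exact moleculeHull_subset_closedBall hD (by omega)
  | succ j ih =>
    intro i hi z hz
    rw [Nat.cast_add_one, weakDerivedIter_add_one]
    have hnext := ih (i + 1) (by omega)
    -- the molecules of the `i`-th generation are averages of those of the next one
    have hsub : moleculeHull D n i ⊆ moleculeHull D n (i + 1) := by
      refine convexHull_min ?_ (convex_convexHull ℝ _)
      rintro _ ⟨w, hw, rfl⟩
      have h := midpoint_diamondMolecule (D := D) n w (by rw [hw.out]; omega) 0 0
      rw [_root_.sub_self, smul_zero, add_zero] at h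
      rw [← h]
      exact half_add_half_mem_moleculeHull hw _ _
    refine mem_weakDerivedSet_of_forall (hnext (hsub hz)) fun V hV hzV => ?_
    obtain ⟨y, hy, hzy⟩ := exists_mem_moleculeHull_one_le_dist hD (by omega) hz hV hzV
    exact ⟨y, ⟨hy.1, hnext hy.2⟩, hzy⟩

open scoped Ordinal

/-- The molecule of the poles is the same element for every depth `n`, hence survives `n`
derivations for each `n`. -/
theorem diamondMolecule_nil_mem_weakDerivedIter_omega0 (hD : IsFreeEmbedding D) :
    diamondMolecule D 0 [] ∈
      weakDerivedIter 1 (Metric.closedBall (0 : X) 1) (ω : Ordinal.{0}) := by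
  rw [weakDerivedIter_limit _ _ _ Ordinal.isSuccLimit_omega0]
  refine Set.mem_iInter₂.2 fun β hβ => ?_
  obtain ⟨n, rfl⟩ := Ordinal.lt_omega0.1 hβ
  have h : diamondMolecule D 0 [] = diamondMolecule D n [] := by
    have h1 : vertexImage D 0 [] .top = vertexImage D n [] .top := by
      rw [vertexImage, vertexImage, diamondVertex_nil_top, diamondVertex_nil_top]
      exact congrArg _ (toDiamondOmega_pole 0 n true)
    have h2 : vertexImage D 0 [] .bot = vertexImage D n [] .bot := by
      rw [vertexImage, vertexImage, diamondVertex_nil_bot, diamondVertex_nil_bot]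
      exact congrArg _ (toDiamondOmega_pole 0 n false)
    rw [diamondMolecule, diamondMolecule, h1, h2]
  rw [h]
  exact moleculeHull_subset_weakDerivedIter hD n n 0 (zero_add n)
    (subset_convexHull ℝ _ ⟨[], rfl, rfl⟩)

theorem omega0_mul_lt_weakFragIndexAt {X : Type} [NormedAddCommGroup X] [NormedSpace ℝ X]
    {D : DiamondOmega → X} (hD : IsFreeEmbedding D) (m : ℕ) :
    ((ω * m : Ordinal.{0}) : WithTop Ordinal.{0}) <
      weakFragIndexAt X ((1 / 3 : ℝ) ^ m * 1) := by
  have hmem := smul_mem_weakDerivedIter_omega0_mul zero_le_one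
    (diamondMolecule_nil_mem_weakDerivedIter_omega0 hD) m 0 (Metric.mem_closedBall_self zero_le_one)
  have hle : ((ω * m + 1 : Ordinal.{0}) : WithTop Ordinal.{0}) ≤
      weakFragIndexAt X ((1 / 3 : ℝ) ^ m * 1) := by
    refine le_sInf ?_
    rintro _ ⟨α, rfl, hα⟩
    refine WithTop.coe_le_coe.2 (Order.add_one_le_of_lt ?_)
    by_contra! hlt
    have := weakDerivedIter_antitone _ _ hlt hmem
    rw [hα] at this
    exact this
  exact (WithTop.coe_lt_coe.2 (Order.lt_add_one_iff.2 le_rfl)).trans_le hle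

end Molecules

theorem isFreeEmbedding_freeDelta : IsFreeEmbedding (freeDelta DiamondOmega.base) where
  norm_sub_le := norm_freeDelta_sub_le
  exists_dual F hF := ⟨freeEval F, freeEval_le_norm hF, fun x => freeDelta_apply x F⟩

end

/-- The weak-fragmentability index of the Lipschitz-free space over `D_ω` is `ω ^ 2`. -/
theorem proposition3p10 :
    weakFragIndex (lipschitzFree DiamondOmega DiamondOmega.base) =
      ((Ordinal.omega0 ^ 2 : Ordinal.{0}) : WithTop Ordinal.{0}) := by
  refine le_antisymm (iSup_le fun ε => diamondExhaustion.weakFragIndexAt_le ε.2) ?_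
  refine le_of_forall_lt fun a ha => ?_
  obtain ⟨α, rfl⟩ := WithTop.ne_top_iff_exists.1 ha.ne_top
  -- Every ordinal below `ω * ω` lies below some `ω * m`, so it suffices to exceed these.
  rw [WithTop.coe_lt_coe, pow_two, Ordinal.lt_mul_iff_of_isSuccLimit Ordinal.isSuccLimit_omega0] at ha
  obtain ⟨β, hβ, hα⟩ := ha
  obtain ⟨m, rfl⟩ := Ordinal.lt_omega0.1 hβ
  refine (WithTop.coe_lt_coe.2 hα).trans ((omega0_mul_lt_weakFragIndexAt isFreeEmbedding_freeDelta m).trans_le ?_)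
  exact le_iSup (fun ε : {ε : ℝ // 0 < ε} => weakFragIndexAt
    (lipschitzFree DiamondOmega DiamondOmega.base) ε) ⟨(1 / 3 : ℝ) ^ m * 1, by positivity⟩
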